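/- **Model.** Programs run on a randomized word RAM with words of $w=\Theta(\log n+\log|\Sigma|)$ bits: addition, subtraction, multiplication, division with remainder, comparison, reading a symbol of an input string at a given position, reading or writing a memory cell (initially $0$) at a given address, and drawing a uniformly random word each take one step. Symbols of $\Sigma$ are coded by $1,\dots,|\Sigma|$. For strings $A,B$, $\operatorname{ED}(A,B)$ is the least number of insertions, deletions and substitutions of single symbols that turn $A$ into $B$, and $\log$ is the logarithm to base $2$. **Theorem.** There are a randomized program $\mathsf{Pre}$, a deterministic program $\mathsf{Query}$ and constants $C,c$ such that for every finite alphabet $\Sigma$, all integers $n\ge 2$ and $1\le k\le n$, and all $A,B\in\Sigma^n$ the following hold, where $\mathsf{Pre}$ is given $n,k,|\Sigma|$ and $A$ (but not $B$), and $\mathsf{Query}$ is given $n,k,|\Sigma|$, $A$, $B$ and the memory that $\mathsf{Pre}$ has left: 1. the expected number of steps of $\mathsf{Pre}$ is at most $C\,n\,(\log n)^c$, that is, $\tilde O(n)$; 2. for every outcome of the preprocessing, $\mathsf{Query}$ halts after at most $C\,\frac nk\,(\log n)^c$ steps, that is, in time $\tilde O(n/k)$; 3. with probability at least $1-\frac1n$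 over the random words drawn by $\mathsf{Pre}$ (independently of $B$), $\mathsf{Query}$ answers SMALL if $\operatorname{ED}(A,B)\le \frac{k}{2\log n}$ and LARGE if $\operatorname{ED}(A,B)>40k^2$. -/

import Mathlib

open MeasureTheory
open scoped ENNReal

noncomputable section

/-! ## Randomized word RAM programs with a step count

A program is a fixed finite piece of syntax, independent of the input. All values are words of `w`
bits, that is, natural numbers below `2 ^ w`. There are registers, finitely many of which occur in
a given program, and arrays of words (again, finitely many occur in a program) that are indexed by
words. -/

namespace WordRAM

/-- The binary word operations. -/
inductive Op where
  | add | sub | mul | div | mod | lt | eq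

/-- Arithmetic is modulo `2 ^ w`; subtraction is cut off at `0`; division by `0` gives `0`;
comparisons give `1` for true and `0` for false. -/
def Op.eval (w : ℕ) : Op → ℕ → ℕ → ℕ
  | .add, a, b => (a + b) % 2 ^ w
  | .sub, a, b => a - b
  | .mul, a, b => (a * b) % 2 ^ w
  | .div, a, b => a / b
  | .mod, a, b => a % b
  | .lt, a, b => if a < b then 1 else 0
  | .eq, a, b => if a = b then 1 else 0

/-- Expressions: constants, registers, binary operations, an entry of a work array (the array is
named by a fixed number, the address is computed), an entry of the first or of the second input
string. -/
inductive Expr where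
  | const (c : ℕ)
  | reg (r : ℕ)
  | bin (o : Op) (e₁ e₂ : Expr)
  | load (arr : ℕ) (e : Expr)
  | inA (e : Expr)
  | inB (e : Expr)

/-- Commands. `rand r` puts a fresh uniformly random word into register `r`. -/
inductive Cmd where
  | skip
  | assign (r : ℕ) (e : Expr)
  | store (arr : ℕ) (addr val : Expr)
  | rand (r : ℕ)
  | seq (c₁ c₂ : Cmd)
  | branch (e : Expr) (c₁ c₂ : Cmd)
  | loop (e : Expr) (c : Cmd)

/-- What a program cannot change: the word length, the two read-only input strings, and the tape
from which the random words are taken one after the other. -/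
structure Env where
  w : ℕ
  strA : ℕ → ℕ
  strB : ℕ → ℕ
  tape : ℕ → ℕ

/-- Registers, work arrays, and the number of random words used so far. -/
structure State where
  reg : ℕ → ℕ
  mem : ℕ → ℕ → ℕ
  pos : ℕ

def Expr.eval (E : Env) (s : State) : Expr → ℕ
  | .const c => c % 2 ^ E.w
  | .reg r => s.reg r
  | .bin o e₁ e₂ => o.eval E.w (e₁.eval E s) (e₂.eval E s)
  | .load arr e => s.mem arr (e.eval E s)
  | .inA e => E.strA (e.eval E s)
  | .inB e => E.strB (e.eval E s)

/-- One step for every constant, register access, memory or input access and word operation. -/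
def Expr.cost : Expr → ℕ
  | .const _ => 1
  | .reg _ => 1
  | .bin _ e₁ e₂ => e₁.cost + e₂.cost + 1
  | .load _ e => e.cost + 1
  | .inA e => e.cost + 1
  | .inB e => e.cost + 1

def State.setReg (s : State) (r v : ℕ) : State :=
  { s with reg := Function.update s.reg r v }

def State.setMem (s : State) (arr a v : ℕ) : State :=
  { s with mem := Function.update s.mem arr (Function.update (s.mem arr) a v) }

/-- `Exec E c s s' t`: started in state `s`, the command `c` halts in state `s'` after exactly `t`
steps. A test holds when its value is not `0`. -/
inductive Exec (E : Env) : Cmd → State → State → ℕ → Prop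
  | skip (s : State) : Exec E .skip s s 1
  | assign (s : State) (r : ℕ) (e : Expr) :
      Exec E (.assign r e) s (s.setReg r (e.eval E s)) (e.cost + 1)
  | store (s : State) (arr : ℕ) (addr val : Expr) :
      Exec E (.store arr addr val) s (s.setMem arr (addr.eval E s) (val.eval E s))
        (addr.cost + val.cost + 1)
  | rand (s : State) (r : ℕ) :
      Exec E (.rand r) s { s.setReg r (E.tape s.pos) with pos := s.pos + 1 } 1
  | seq {c₁ c₂ : Cmd} {s s' s'' : State} {t₁ t₂ : ℕ} :
      Exec E c₁ s s' t₁ → Exec E c₂ s' s'' t₂ → Exec E (.seq c₁ c₂) s s'' (t₁ + t₂)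
  | branch_true {e : Expr} {c₁ c₂ : Cmd} {s s' : State} {t : ℕ} :
      e.eval E s ≠ 0 → Exec E c₁ s s' t → Exec E (.branch e c₁ c₂) s s' (e.cost + 1 + t)
  | branch_false {e : Expr} {c₁ c₂ : Cmd} {s s' : State} {t : ℕ} :
      e.eval E s = 0 → Exec E c₂ s s' t → Exec E (.branch e c₁ c₂) s s' (e.cost + 1 + t)
  | loop_true {e : Expr} {c : Cmd} {s s' s'' : State} {t₁ t₂ : ℕ} :
      e.eval E s ≠ 0 → Exec E c s s' t₁ → Exec E (.loop e c) s' s'' t₂ →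
      Exec E (.loop e c) s s'' (e.cost + 1 + t₁ + t₂)
  | loop_false {e : Expr} {c : Cmd} {s : State} :
      e.eval E s = 0 → Exec E (.loop e c) s s (e.cost + 1)

/-- The number of steps of `c` from `s`, equal to `∞` if `c` does not halt. -/
def runtime (E : Env) (c : Cmd) (s : State) : ℝ≥0∞ :=
  ⨅ (s' : State) (t : ℕ) (_ : Exec E c s s' t), (t : ℝ≥0∞)

/-- The program draws no random words. -/
def Cmd.RandFree : Cmd → Prop
  | .skip => True
  | .assign _ _ => True
  | .store _ _ _ => True
  | .rand _ => False
  | .seq c₁ c₂ => c₁.RandFree ∧ c₂.RandFree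
  | .branch _ c₁ c₂ => c₁.RandFree ∧ c₂.RandFree
  | .loop _ c => c.RandFree

/-- Infinite tapes of words of `w` bits. -/
abbrev Tape (w : ℕ) : Type := ℕ → Fin (2 ^ w)

/-- The law of a tape of independent uniformly random words. -/
def tapeMeasure (w : ℕ) : Measure (Tape w) :=
  Measure.infinitePi fun _ : ℕ => (PMF.uniformOfFintype (Fin (2 ^ w))).toMeasure

end WordRAM

/-! ## Gap edit distance with preprocessing of one string -/

namespace GapEdit

open WordRAM

/-- A single edit: an insertion, a deletion or a substitution of one symbol. -/
inductive EditStep {α : Type} : List α → List α → Prop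
  | insert (u v : List α) (a : α) : EditStep (u ++ v) (u ++ a :: v)
  | delete (u v : List α) (a : α) : EditStep (u ++ a :: v) (u ++ v)
  | subst (u v : List α) (a b : α) : EditStep (u ++ a :: v) (u ++ b :: v)

/-- `Edits m x y`: some sequence of exactly `m` edits turns `x` into `y`. -/
inductive Edits {α : Type} : ℕ → List α → List α → Prop
  | refl (x : List α) : Edits 0 x x
  | step {m : ℕ} {x y z : List α} : Edits m x y → EditStep y z → Edits (m + 1) x z

/-- The edit distance: the least number of insertions, deletions and substitutions that turn one
string into the other. -/
def editDist {σ n : ℕ} (A B : Fin n → Fin σ) : ℕ :=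
  sInf {m | Edits m (List.ofFn A) (List.ofFn B)}

/-- A string as it is given to the machine: positions are `0, …, n - 1`, the symbols are coded by
`1, …, σ`, and every position out of range holds `0`. -/
def encode {σ n : ℕ} (A : Fin n → Fin σ) (i : ℕ) : ℕ :=
  if h : i < n then (A ⟨i, h⟩ : ℕ) + 1 else 0

/-- The word length `c₀ · Θ(log n + log σ)`. -/
def wordSize (c₀ n σ : ℕ) : ℕ := c₀ * (Nat.size n + Nat.size σ)

/-- The registers when a program starts: `n`, `k`, `σ`, the largest word, and zeros. -/
def initReg (w n k σ : ℕ) : ℕ → ℕ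
  | 0 => n
  | 1 => k
  | 2 => σ
  | 3 => 2 ^ w - 1
  | _ => 0

/-- While `A` is preprocessed there is no second string. -/
def preEnv {σ n : ℕ} (w : ℕ) (A : Fin n → Fin σ) (ω : Tape w) : Env where
  w := w
  strA := encode A
  strB := fun _ => 0
  tape := fun i => (ω i : ℕ)

/-- The preprocessing starts with empty memory. -/
def preInit (w n k σ : ℕ) : State where
  reg := initReg w n k σ
  mem := fun _ _ => 0
  pos := 0

/-- A query can read both strings. It has no random words. -/
def queryEnv {σ n : ℕ} (w : ℕ) (A B : Fin n → Fin σ) : Env where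
  w := w
  strA := encode A
  strB := encode B
  tape := fun _ => 0

/-- A query starts with the memory that the preprocessing has left, and with fresh registers. -/
def queryInit (w n k σ : ℕ) (s : State) : State where
  reg := initReg w n k σ
  mem := s.mem
  pos := 0

/-- The answer is read from register `0`: the value `1` stands for SMALL, the value `0` for
LARGE. -/
def Correct {σ n : ℕ} (k : ℕ) (A B : Fin n → Fin σ) (s : State) : Prop :=
  ((editDist A B : ℝ) ≤ k / (2 * Real.logb 2 n) → s.reg 0 = 1) ∧
  ((40 * (k : ℝ) ^ 2 < editDist A B) → s.reg 0 = 0)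

end GapEdit

end

/-! The positions are cut into `2 ^ h` (about `n / k`) blocks of length `k`, and `2 ^ t = Θ(log n)`
random positions are sampled in each block. The samples are the leaves of a binary tree whose upper
`h + 1` levels stand for dyadic unions of blocks. With `l = ⌊log n⌋` and `s = ⌊k / (2l)⌋`, the
preprocessing labels a copy of this tree for each of the `2s + 1` shifts in `[-s, s]`, with the
symbols of `A` read at the shifted samples. It names the nodes bottom-up: a dictionary sends a node
together with the names of its two children to a name. Since memory starts at `0` and the keys fit
in a word, the dictionary is a plain array. The work is about `(n / k) * log n * (k / log n)`, up to
logarithmic factors. The query reads `B` at the samples only and looks the names up bottom-up; a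
node gets a nonzero name exactly if some shift of `A` agrees with `B` on all samples below it
(`Naming.lookup_ne_zero_iff`). The answer is SMALL if at most `s * (l + 2)` nodes of the upper
levels fail.

Small distance: if `ED(A,B) ≤ s`, at most `s` breakpoints cut `B` into pieces that are copies of
pieces of `A` under shifts of size at most `s` (`Edits.exists_breakpoints`). Only nodes whose
interval contains a breakpoint can fail, at most `s` on each of `h + 1 ≤ l + 2` levels. This side
uses no randomness.

Large distance: a node and a shift with more than `k` mismatches escape all samples with probability
at most `exp (-2 ^ t / 2)`, and a union bound over nodes and shifts gives total failure at most `1 /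
n` (`Dims.tapeMeasure_reveals`). Otherwise every node that succeeds costs at most `k + 2 * s` edits.
Descending from the root through the failing nodes splits the string into at most one more piece
than there are failures, each of cost `O(k)` (`exists_edits_of_zeros`). As `s * (l + 2) = O(k)`, few
failures force `ED(A,B) = O(k ^ 2)`.

The time bounds hold for every tape, so the expectation plays no real role. -/

noncomputable section

namespace WordRAM

/-! ### Execution is deterministic -/

/-- The claim about queries starts from an arbitrary halting run of the preprocessing; determinism
identifies that run with the one that is analysed. -/
theorem Exec.deterministic {E : Env} {c : Cmd} {s s₁ : State} {t₁ : ℕ} (h₁ : Exec E c s s₁ t₁) :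
    ∀ {s₂ : State} {t₂ : ℕ}, Exec E c s s₂ t₂ → s₁ = s₂ ∧ t₁ = t₂ := by
  induction h₁ with
  | skip s => intro s₂ t₂ h; cases h; exact ⟨rfl, rfl⟩
  | assign s r e => intro s₂ t₂ h; cases h; exact ⟨rfl, rfl⟩
  | store s arr addr val => intro s₂ t₂ h; cases h; exact ⟨rfl, rfl⟩
  | rand s r => intro s₂ t₂ h; cases h; exact ⟨rfl, rfl⟩
  | seq _ _ ih₁ ih₂ =>
    intro s₂ t₂ h
    cases h with
    | seq ha hb =>
      obtain ⟨rfl, rfl⟩ := ih₁ ha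
      obtain ⟨rfl, rfl⟩ := ih₂ hb
      exact ⟨rfl, rfl⟩
  | branch_true he _ ih =>
    intro s₂ t₂ h
    cases h with
    | branch_true _ ha => obtain ⟨rfl, rfl⟩ := ih ha; exact ⟨rfl, rfl⟩
    | branch_false he' _ => exact absurd he' he
  | branch_false he _ ih =>
    intro s₂ t₂ h
    cases h with
    | branch_true he' _ => exact absurd he he'
    | branch_false _ ha => obtain ⟨rfl, rfl⟩ := ih ha; exact ⟨rfl, rfl⟩
  | loop_true he _ _ ih₁ ih₂ =>
    intro s₂ t₂ h
    cases h with
    | loop_true _ ha hb =>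
      obtain ⟨rfl, rfl⟩ := ih₁ ha
      obtain ⟨rfl, rfl⟩ := ih₂ hb
      exact ⟨rfl, rfl⟩
    | loop_false he' => exact absurd he' he
  | loop_false he =>
    intro s₂ t₂ h
    cases h with
    | loop_true he' _ _ => exact absurd he he'
    | loop_false _ => exact ⟨rfl, rfl⟩

/-! ### Total correctness with a time bound -/

/-- From `s`, the command `c` halts within `b` steps in a state that satisfies `Q`. -/
def Runs (E : Env) (c : Cmd) (s : State) (b : ℕ) (Q : State → Prop) : Prop :=
  ∃ (s' : State) (t : ℕ), Exec E c s s' t ∧ t ≤ b ∧ Q s'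

variable {E : Env} {s : State} {Q R : State → Prop} {b b' : ℕ}

theorem Runs.mono {c : Cmd} (h : Runs E c s b R) (hb : b ≤ b') (hQ : ∀ s', R s' → Q s') :
    Runs E c s b' Q := by
  obtain ⟨s', t, he, ht, hr⟩ := h
  exact ⟨s', t, he, ht.trans hb, hQ _ hr⟩

theorem Runs.skip (h : Q s) : Runs E .skip s 1 Q := ⟨_, _, .skip s, le_rfl, h⟩

theorem Runs.assign {r : ℕ} {e : Expr} (h : Q (s.setReg r (e.eval E s))) :
    Runs E (.assign r e) s (e.cost + 1) Q := ⟨_, _, .assign s r e, le_rfl, h⟩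

theorem Runs.store {arr : ℕ} {a v : Expr} (h : Q (s.setMem arr (a.eval E s) (v.eval E s))) :
    Runs E (.store arr a v) s (a.cost + v.cost + 1) Q := ⟨_, _, .store s arr a v, le_rfl, h⟩

theorem Runs.rand {r : ℕ} (h : Q { s.setReg r (E.tape s.pos) with pos := s.pos + 1 }) :
    Runs E (.rand r) s 1 Q := ⟨_, _, .rand s r, le_rfl, h⟩

theorem Runs.seq {c₁ c₂ : Cmd} (h : Runs E c₁ s b fun s' => Runs E c₂ s' b' Q) :
    Runs E (.seq c₁ c₂) s (b + b') Q := by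
  obtain ⟨s', t, he, ht, s'', t', he', ht', hq⟩ := h
  exact ⟨s'', t + t', he.seq he', add_le_add ht ht', hq⟩

theorem Runs.branch {e : Expr} {c₁ c₂ : Cmd} (h₁ : e.eval E s ≠ 0 → Runs E c₁ s b Q)
    (h₂ : e.eval E s = 0 → Runs E c₂ s b Q) : Runs E (.branch e c₁ c₂) s (e.cost + 1 + b) Q := by
  by_cases h : e.eval E s = 0
  · obtain ⟨s', t, he, ht, hq⟩ := h₂ h
    exact ⟨s', _, .branch_false h he, by omega, hq⟩
  · obtain ⟨s', t, he, ht, hq⟩ := h₁ h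
    exact ⟨s', _, .branch_true h he, by omega, hq⟩

/-- `I m` is the invariant when `m` iterations are still to come. -/
theorem Runs.loop {e : Expr} {c : Cmd} (I : ℕ → State → Prop)
    (hstep : ∀ m s, I (m + 1) s → e.eval E s ≠ 0 ∧ Runs E c s b (I m))
    (hend : ∀ s, I 0 s → e.eval E s = 0) :
    ∀ (m : ℕ) (s : State), I m s →
      Runs E (.loop e c) s (m * (e.cost + 1 + b) + (e.cost + 1)) (I 0) := by
  intro m
  induction m with
  | zero => exact fun s h => ⟨s, _, .loop_false (hend s h), by omega, h⟩
  | succ m ih =>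
    intro s h
    obtain ⟨hne, s', t, he, ht, hi⟩ := hstep m s h
    obtain ⟨s'', t', he', ht', hi'⟩ := ih s' hi
    refine ⟨s'', _, .loop_true hne he he', ?_, hi'⟩
    rw [Nat.succ_mul]; omega

theorem Runs.runtime_le {c : Cmd} (h : Runs E c s b Q) : runtime E c s ≤ (b : ℝ≥0∞) := by
  obtain ⟨s', t, he, ht, -⟩ := h
  refine (iInf_le_of_le s' (iInf_le_of_le t (iInf_le_of_le he le_rfl))).trans ?_
  exact_mod_cast ht

end WordRAM

namespace GapEdit

variable {α : Type}

/-! ### Edit sequences -/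

theorem Edits.trans {m m' : ℕ} {x y z : List α} (h : Edits m x y) (h' : Edits m' y z) :
    Edits (m + m') x z := by
  induction h' with
  | refl _ => exact h
  | step _ hs ih => exact (ih h).step hs

theorem EditStep.append_left {x y : List α} (h : EditStep x y) (l : List α) :
    EditStep (l ++ x) (l ++ y) := by
  cases h with
  | insert u v a => simpa using EditStep.insert (l ++ u) v a
  | delete u v a => simpa using EditStep.delete (l ++ u) v a
  | subst u v a b => simpa using EditStep.subst (l ++ u) v a b

theorem EditStep.append_right {x y : List α} (h : EditStep x y) (l : List α) :
    EditStep (x ++ l) (y ++ l) := by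
  cases h with
  | insert u v a => simpa using EditStep.insert u (v ++ l) a
  | delete u v a => simpa using EditStep.delete u (v ++ l) a
  | subst u v a b => simpa using EditStep.subst u (v ++ l) a b

theorem Edits.append_left {m : ℕ} {x y : List α} (h : Edits m x y) (l : List α) :
    Edits m (l ++ x) (l ++ y) := by
  induction h with
  | refl _ => exact .refl _
  | step _ hs ih => exact ih.step (hs.append_left l)

theorem Edits.append_right {m : ℕ} {x y : List α} (h : Edits m x y) (l : List α) :
    Edits m (x ++ l) (y ++ l) := by
  induction h with
  | refl _ => exact .refl _
  | step _ hs ih => exact ih.step (hs.append_right l)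

theorem Edits.append {m m' : ℕ} {x y x' y' : List α} (h : Edits m x y) (h' : Edits m' x' y') :
    Edits (m + m') (x ++ x') (y ++ y') :=
  (h.append_right x').trans (h'.append_left y)

theorem edits_delete (u : List α) : Edits u.length u [] := by
  induction u with
  | nil => exact .refl _
  | cons a u ih =>
    have h : Edits 1 (a :: u) u := (Edits.refl (a :: u)).step (EditStep.delete [] u a)
    simpa [add_comm] using h.trans ih

theorem edits_insert (u : List α) : Edits u.length [] u := by
  induction u with
  | nil => exact .refl _
  | cons a u ih => exact ih.step (EditStep.insert [] u a)

/-- The substring of `f` of length `m` that starts at position `a`. -/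
def seg (f : ℕ → α) (a m : ℕ) : List α := (List.range' a m).map f

theorem seg_add (f : ℕ → α) (a m m' : ℕ) : seg f a (m + m') = seg f a m ++ seg f (a + m) m' := by
  simp [seg, ← List.map_append]

@[simp] theorem length_seg (f : ℕ → α) (a m : ℕ) : (seg f a m).length = m := by simp [seg]

theorem edits_seg_hamming [DecidableEq α] (f g : ℕ → α) (a b m : ℕ) :
    Edits ((Finset.range m).filter fun i => f (a + i) ≠ g (b + i)).card
      (seg f a m) (seg g b m) := by
  induction m with
  | zero => exact .refl _
  | succ m ih =>
    rw [seg_add, seg_add, Finset.range_add_one, Finset.filter_insert]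
    by_cases h : f (a + m) = g (b + m)
    · rw [if_neg (by simpa using h)]
      have : seg f (a + m) 1 = seg g (b + m) 1 := by simp [seg, h]
      rw [this]
      exact ih.append_right _
    · rw [if_pos h, Finset.card_insert_of_notMem (by simp)]
      refine ih.append (m' := 1) ?_
      exact (Edits.refl _).step (by simpa [seg] using EditStep.subst [] [] (f (a + m)) (g (b + m)))

/-- Two substrings at the same place that agree up to the shift `d - s`, except in few positions. -/
theorem exists_edits_seg_of_shift [DecidableEq α] (f g : ℕ → α) (a m s d c : ℕ) (hd : d ≤ 2 * s)
    (S : Finset ℕ) (hS : S.card ≤ c)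
    (h : ∀ p, a ≤ p → p < a + m → s ≤ p + d → p + d - s < a + m → p ∉ S → f (p + d - s) = g p) :
    ∃ r ≤ c + 2 * s, Edits r (seg f a m) (seg g a m) := by
  -- A segment no longer than `s` is simply rewritten. Otherwise the shift is at most the length,
  -- and it is undone by deleting a piece at one end, substituting at the exceptional positions of
  -- the overlap, and inserting a piece at the other end.
  rcases le_total m s with hm | hm
  · refine ⟨m + m, by omega, ?_⟩
    simpa using (edits_delete (seg f a m)).trans (edits_insert (seg g a m))
  rcases le_total s d with hsd | hsd
  · obtain ⟨e, rfl⟩ := Nat.exists_eq_add_of_le hsd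
    obtain ⟨m, rfl⟩ := Nat.exists_eq_add_of_le (show e ≤ m by omega)
    have h1 := edits_delete (seg f a e)
    have h2 := edits_seg_hamming f g (a + e) a m
    have h3 := edits_insert (seg g (a + m) e)
    refine ⟨_, ?_, by simpa [← seg_add, add_comm m e] using (h1.append h2).append h3⟩
    · have : ((Finset.range m).filter fun i => ¬ f (a + e + i) = g (a + i)).card ≤ S.card := by
        refine Finset.card_le_card_of_injOn (fun i => a + i) ?_ (fun i _ j _ hij => by simpa using hij)
        intro i hi
        simp only [Finset.coe_filter, Finset.mem_range, Set.mem_ofPred_eq] at hi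
        by_contra hc
        refine hi.2 ?_
        have := h (a + i) (by omega) (by omega) (by omega) (by omega) hc
        rwa [show a + i + (s + e) - s = a + e + i by omega] at this
      omega
  · obtain ⟨e, rfl⟩ := Nat.exists_eq_add_of_le hsd
    obtain ⟨m, rfl⟩ := Nat.exists_eq_add_of_le (show e ≤ m by omega)
    have h1 := edits_insert (seg g a e)
    have h2 := edits_seg_hamming f g a (a + e) m
    have h3 := edits_delete (seg f (a + m) e)
    refine ⟨_, ?_, by simpa [← seg_add, add_comm m e] using (h1.append h2).append h3⟩
    · have : ((Finset.range m).filter fun i => ¬ f (a + i) = g (a + e + i)).card ≤ S.card := by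
        refine Finset.card_le_card_of_injOn (fun i => a + e + i) ?_
          (fun i _ j _ hij => by simpa using hij)
        intro i hi
        simp only [Finset.coe_filter, Finset.mem_range, Set.mem_ofPred_eq] at hi
        by_contra hc
        refine hi.2 ?_
        have := h (a + e + i) (by omega) (by omega) (by omega) (by omega) hc
        rwa [show a + e + i + d - (d + e) = a + i by omega] at this
      omega

/-! ### The structure of strings at small edit distance -/

/-- After `m` edits there are at most `m` positions such that every interval that avoids them is a
shifted copy of an interval of the original string. -/
theorem Edits.exists_breakpoints {m : ℕ} {x y : List α} (h : Edits m x y) :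
    ∃ S : Finset ℕ, S.card ≤ m ∧ ∀ a b : ℕ, (∀ p, a ≤ p → p < b → p ∉ S) →
      ∃ δ : ℤ, |δ| ≤ m ∧ ∀ p, a ≤ p → p < b → 0 ≤ (p : ℤ) + δ ∧ x[((p : ℤ) + δ).toNat]? = y[p]? := by
  induction h with
  | refl x => exact ⟨∅, by simp, fun a b _ => ⟨0, by simp, fun p _ _ => by simp⟩⟩
  | @step m x y z _ hs ih =>
    obtain ⟨S, hS, H⟩ := ih
    -- All three kinds of edit at once: `u` is the place of the edit, and `f` sends a position after
    -- the edit to its position before it, a translation by `e₁` left of `u` and by `e₂` right of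
    -- `u`. The new breakpoints are `u` and the old ones carried along.
    have key : ∀ (u : ℕ) (S' : Finset ℕ) (f : ℕ → ℕ) (_ : S'.card ≤ m)
        (e₁ e₂ : ℤ) (_ : |e₁| ≤ 1) (_ : |e₂| ≤ 1)
        (_ : ∀ p < u, (f p : ℤ) = p + e₁) (_ : ∀ p > u, (f p : ℤ) = p + e₂)
        (_ : ∀ p, p ≠ u → f p ∈ S → p ∈ S') (_ : ∀ p, p ≠ u → y[f p]? = z[p]?),
        ∃ S : Finset ℕ, S.card ≤ m + 1 ∧ ∀ a b : ℕ, (∀ p, a ≤ p → p < b → p ∉ S) →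
          ∃ δ : ℤ, |δ| ≤ (m + 1 : ℕ) ∧
            ∀ p, a ≤ p → p < b → 0 ≤ (p : ℤ) + δ ∧ x[((p : ℤ) + δ).toNat]? = z[p]? := by
      intro u S' f hc e₁ e₂ he₁ he₂ hf₁ hf₂ hmem hyz
      refine ⟨insert u S', (Finset.card_insert_le _ _).trans (by omega), fun a b hab => ?_⟩
      -- On one side of `u`, the interval is carried by a translation to an interval that avoids the
      -- old breakpoints, and the two shifts add up.
      have side : ∀ e : ℤ, |e| ≤ 1 → (∀ p, a ≤ p → p < b → p ≠ u → (f p : ℤ) = p + e) →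
          ∃ δ : ℤ, |δ| ≤ (m + 1 : ℕ) ∧
            ∀ p, a ≤ p → p < b → 0 ≤ (p : ℤ) + δ ∧ x[((p : ℤ) + δ).toNat]? = z[p]? := by
        intro e he hfe
        rcases le_or_gt b a with hba | hba
        · exact ⟨0, by simpa using by positivity, fun p h1 h2 => absurd h1 (by omega)⟩
        have hne : ∀ p, a ≤ p → p < b → p ≠ u := fun p h1 h2 h3 =>
          hab p h1 h2 (by simp [h3])
        have hfa := hfe a le_rfl hba (hne a le_rfl hba)
        obtain ⟨δ, hδ, hp⟩ := H (f a) (f a + (b - a)) (by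
          intro p h1 h2 hpS
          have h3 := hfe (a + (p - f a)) (by omega) (by omega) (hne _ (by omega) (by omega))
          have h4 : f (a + (p - f a)) = p := by omega
          refine hab (a + (p - f a)) (by omega) (by omega) (Finset.mem_insert_of_mem ?_)
          exact hmem _ (hne _ (by omega) (by omega)) (by rwa [h4]))
        refine ⟨δ + e, (abs_add_le _ _).trans (by push_cast; omega), fun p h1 h2 => ?_⟩
        have h3 := hfe p h1 h2 (hne p h1 h2)
        obtain ⟨h4, h5⟩ := hp (f p) (by omega) (by omega)
        rw [hyz p (hne p h1 h2)] at h5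
        have h6 : (f p : ℤ) + δ = p + (δ + e) := by omega
        rw [h6] at h4 h5
        exact ⟨h4, h5⟩
      have hau : u < a ∨ b ≤ u := by
        by_contra hcon
        exact hab u (by omega) (by omega) (by simp)
      rcases hau with hau | hau
      · exact side e₂ he₂ fun p h1 _ _ => hf₂ p (by omega)
      · exact side e₁ he₁ fun p _ h2 _ => hf₁ p (by omega)
    cases hs with
    | insert u v c =>
      refine key u.length (S.image fun p => if p < u.length then p else p + 1)
        (fun p => if p < u.length then p else p - 1) (Finset.card_image_le.trans hS)
        0 (-1) (by simp) (by simp) (fun p hp => by simp [hp])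
        (fun p hp => by rw [if_neg (by omega)]; omega) ?_ ?_
      · intro p hp hpS
        refine Finset.mem_image.2 ⟨_, hpS, ?_⟩
        split_ifs <;> omega
      · intro p hp
        rcases lt_or_gt_of_ne hp with h | h
        · simp [h, List.getElem?_append]
        · obtain ⟨q, rfl⟩ := Nat.exists_eq_add_of_lt h
          have h0 : ¬ u.length + q + 1 < u.length := by omega
          simp only [List.getElem?_append, List.getElem?_cons, h0, if_false]
          rw [if_neg (by omega), if_neg (by omega)]
          congr 1; omega
    | delete u v c =>
      refine key u.length (S.image fun p => if p < u.length then p else p - 1)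
        (fun p => if p < u.length then p else p + 1) (Finset.card_image_le.trans hS)
        0 1 (by simp) (by simp) (fun p hp => by simp [hp])
        (fun p hp => by rw [if_neg (by omega)]; omega) ?_ ?_
      · intro p hp hpS
        refine Finset.mem_image.2 ⟨_, hpS, ?_⟩
        split_ifs <;> omega
      · intro p hp
        rcases lt_or_gt_of_ne hp with h | h
        · simp [h, List.getElem?_append]
        · obtain ⟨q, rfl⟩ := Nat.exists_eq_add_of_lt h
          have h0 : ¬ u.length + q + 1 < u.length := by omega
          simp only [List.getElem?_append, List.getElem?_cons, h0, if_false]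
          rw [if_neg (by omega), if_neg (by omega)]
          congr 1; omega
    | subst u v c c' =>
      refine key u.length S id hS 0 0 (by simp) (by simp) (fun p _ => by simp)
        (fun p _ => by simp) (fun p _ h => h) ?_
      intro p hp
      rcases lt_or_gt_of_ne hp with h | h
      · simp [h, List.getElem?_append]
      · obtain ⟨q, rfl⟩ := Nat.exists_eq_add_of_lt h
        simp only [List.getElem?_append, List.getElem?_cons, id]
        rw [if_neg (by omega), if_neg (by omega), if_neg (by omega), if_neg (by omega)]

theorem edits_editDist {σ n : ℕ} (A B : Fin n → Fin σ) :
    Edits (editDist A B) (List.ofFn A) (List.ofFn B) :=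
  Nat.sInf_mem (s := {m | Edits m (List.ofFn A) (List.ofFn B)})
    ⟨_, (edits_delete (List.ofFn A)).trans (edits_insert (List.ofFn B))⟩

theorem editDist_le {σ n m : ℕ} {A B : Fin n → Fin σ} (h : Edits m (List.ofFn A) (List.ofFn B)) :
    editDist A B ≤ m := Nat.sInf_le h


/-! ### Naming the nodes of a heap-ordered binary tree

Node `i` has the children `2 * i` and `2 * i + 1`, the leaves are `M, …, 2 * M - 1`. Node `i` in
copy `d` of the tree is numbered `i * D + d`. -/

/-- The address of the name of node `i` whose children have the names `l` and `r`. -/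
def pairKey (X i l r : ℕ) : ℕ := (i * X + l) * X + r

/-- The key is a numeral in base `X`. It contains the node `i`, so names are compared only between
copies of one node, and it does no harm that symbols and names of inner nodes overlap as numbers. -/
theorem pairKey_inj {X i l r i' l' r' : ℕ} (hl : l < X) (hr : r < X) (hl' : l' < X) (hr' : r' < X)
    (h : pairKey X i l r = pairKey X i' l' r') : i = i' ∧ l = l' ∧ r = r' := by
  have hX : 0 < X := by omega
  have aux : ∀ {a b a' b' : ℕ}, b < X → b' < X → a * X + b = a' * X + b' → a = a' ∧ b = b' := by
    intro a b a' b' hb hb' h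
    have h1 := congrArg (· / X) h
    have h2 := congrArg (· % X) h
    simp only [add_comm _ b, add_comm _ b', Nat.add_mul_div_right _ _ hX,
      Nat.add_mul_mod_self_right, Nat.div_eq_of_lt hb, Nat.div_eq_of_lt hb',
      Nat.mod_eq_of_lt hb, Nat.mod_eq_of_lt hb', zero_add] at h1 h2
    exact ⟨h1, h2⟩
  obtain ⟨h1, h2⟩ := aux hr hr' h
  obtain ⟨h3, h4⟩ := aux hl hl' h1
  exact ⟨h3, h4, h2⟩

theorem pairKey_lt {X M i l r : ℕ} (hi : i < M) (hl : l < X) (hr : r < X) :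
    pairKey X i l r < M * X * X := by
  have h1 : i * X + l < M * X := by nlinarith
  unfold pairKey
  nlinarith

/-- The address of the name of the node numbered `y`. -/
def slot (X D : ℕ) (cur : ℕ → ℕ) (y : ℕ) : ℕ :=
  pairKey X (y / D) (cur (2 * (y / D) * D + y % D)) (cur ((2 * (y / D) + 1) * D + y % D))

/-- The names given so far, when the nodes numbered at least `z` have been treated: `cur` holds the
names, `tab` the dictionary, `cnt` the number of names in use. -/
structure Naming (leaf : ℕ → ℕ → ℕ) (M D X : ℕ) (tab cur : ℕ → ℕ) (cnt z : ℕ) : Prop where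
  cur_leaf : ∀ y, z ≤ y → M ≤ y / D → y / D < 2 * M → cur y = leaf (y % D) (y / D)
  cur_node : ∀ y, z ≤ y → y / D < M → tab (slot X D cur y) = cur y
  cur_ne : ∀ y, z ≤ y → y / D < 2 * M → cur y ≠ 0
  cur_lt : ∀ y, z ≤ y → y / D < 2 * M → cur y < X
  tab_ne : ∀ a, tab a ≠ 0 → ∃ y, z ≤ y ∧ y / D < M ∧ a = slot X D cur y
  tab_inj : ∀ a a', tab a ≠ 0 → tab a = tab a' → a = a'
  tab_le : ∀ a, tab a ≤ cnt
  cnt_le : cnt + z ≤ 2 * M * D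

variable {leaf : ℕ → ℕ → ℕ} {M D X : ℕ} {tab cur : ℕ → ℕ} {cnt z : ℕ}

/-- No node has a number as large as `2 * M * D`, so all conditions on nodes are vacuous and the old
contents of `cur` do not matter. -/
theorem naming_start (hD : 0 < D) :
    Naming leaf M D X (fun _ => 0) cur 0 (2 * M * D) := by
  have aux : ∀ y, 2 * M * D ≤ y → ¬ y / D < 2 * M := fun y hy h =>
    absurd (Nat.div_lt_iff_lt_mul hD |>.1 h) (by omega)
  have aux' : ∀ y, 2 * M * D ≤ y → ¬ y / D < M := fun y hy h => aux y hy (by omega)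
  exact ⟨fun y h _ h' => absurd h' (aux y h), fun y h h' => absurd h' (aux' y h),
    fun y h h' => absurd h' (aux y h), fun y h h' => absurd h' (aux y h),
    fun a h => absurd rfl h, fun a a' h => absurd rfl h, fun a => le_rfl, by omega⟩

/-- This is why the nodes are treated by decreasing number: children come before their parent. The
assumption `D ≤ y` excludes the index `0`, which would be its own child. -/
theorem lt_child {y : ℕ} (hD : 0 < D) (hy : D ≤ y) : y < 2 * (y / D) * D + y % D ∧
    y < (2 * (y / D) + 1) * D + y % D := by
  have h1 := Nat.div_add_mod y D
  have h2 : 1 ≤ y / D := (Nat.one_le_div_iff hD).2 hy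
  constructor <;> nlinarith

theorem child_div {y : ℕ} (hD : 0 < D) : (2 * (y / D) * D + y % D) / D = 2 * (y / D) ∧
    ((2 * (y / D) + 1) * D + y % D) / D = 2 * (y / D) + 1 := by
  have h := Nat.mod_lt y hD
  constructor <;> rw [mul_comm, Nat.mul_add_div hD, Nat.div_eq_of_lt h, add_zero]

theorem slot_update {y y' v : ℕ} (hD : 0 < D) (hy : D ≤ y) (hy' : y ≤ y') :
    slot X D (Function.update cur y v) y' = slot X D cur y' := by
  have h := lt_child hD (hy.trans hy')
  unfold slot
  rw [Function.update_of_ne (by omega), Function.update_of_ne (by omega)]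

theorem Naming.step_leaf (hN : Naming leaf M D X tab cur cnt (z + 1)) (hD : 0 < D) (hz : D ≤ z)
    (hzM : M ≤ z / D) {v : ℕ} (hv : v = leaf (z % D) (z / D)) (hv0 : v ≠ 0) (hvX : v < X) :
    Naming leaf M D X tab (Function.update cur z v) cnt z := by
  have hlt : ∀ y, z ≤ y → y ≠ z → z + 1 ≤ y := fun y h h' => by omega
  refine ⟨fun y hy h1 h2 => ?_, fun y hy h1 => ?_, fun y hy h1 => ?_, fun y hy h1 => ?_,
    fun a ha => ?_, hN.tab_inj, hN.tab_le, by have := hN.cnt_le; omega⟩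
  · by_cases h : y = z
    · subst h; simp [hv]
    · rw [Function.update_of_ne h]; exact hN.cur_leaf y (hlt y hy h) h1 h2
  · have h : y ≠ z := by rintro rfl; omega
    rw [slot_update hD hz hy, Function.update_of_ne h]
    exact hN.cur_node y (hlt y hy h) h1
  · by_cases h : y = z
    · subst h; simpa using hv0
    · rw [Function.update_of_ne h]; exact hN.cur_ne y (hlt y hy h) h1
  · by_cases h : y = z
    · subst h; simpa using hvX
    · rw [Function.update_of_ne h]; exact hN.cur_lt y (hlt y hy h) h1
  · obtain ⟨y, h1, h2, h3⟩ := hN.tab_ne a ha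
    exact ⟨y, by omega, h2, by rw [slot_update hD hz (by omega)]; exact h3⟩

theorem Naming.step_old (hN : Naming leaf M D X tab cur cnt (z + 1)) (hD : 0 < D) (hz : D ≤ z)
    (hzM : z / D < M) (hX : 2 * M * D < X) (ht : tab (slot X D cur z) ≠ 0) :
    Naming leaf M D X tab (Function.update cur z (tab (slot X D cur z))) cnt z := by
  have hlt : ∀ y, z ≤ y → y ≠ z → z + 1 ≤ y := fun y h h' => by omega
  refine ⟨fun y hy h1 h2 => ?_, fun y hy h1 => ?_, fun y hy h1 => ?_, fun y hy h1 => ?_,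
    fun a ha => ?_, hN.tab_inj, hN.tab_le, by have := hN.cnt_le; omega⟩
  · have h : y ≠ z := by rintro rfl; omega
    rw [Function.update_of_ne h]; exact hN.cur_leaf y (hlt y hy h) h1 h2
  · rw [slot_update hD hz hy]
    by_cases h : y = z
    · subst h; simp
    · rw [Function.update_of_ne h]
      exact hN.cur_node y (hlt y hy h) h1
  · by_cases h : y = z
    · subst h; simpa using ht
    · rw [Function.update_of_ne h]; exact hN.cur_ne y (hlt y hy h) h1
  · by_cases h : y = z
    · subst h
      have h1 := hN.tab_le (slot X D cur y)
      have h2 := hN.cnt_le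
      simp only [Function.update_self]
      omega
    · rw [Function.update_of_ne h]; exact hN.cur_lt y (hlt y hy h) h1
  · obtain ⟨y, h1, h2, h3⟩ := hN.tab_ne a ha
    exact ⟨y, by omega, h2, by rw [slot_update hD hz (by omega)]; exact h3⟩

theorem Naming.step_new (hN : Naming leaf M D X tab cur cnt (z + 1)) (hD : 0 < D) (hz : D ≤ z)
    (hzM : z / D < M) (hX : 2 * M * D < X) (ht : tab (slot X D cur z) = 0) :
    Naming leaf M D X (Function.update tab (slot X D cur z) (cnt + 1))
      (Function.update cur z (cnt + 1)) (cnt + 1) z := by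
  have hlt : ∀ y, z ≤ y → y ≠ z → z + 1 ≤ y := fun y h h' => by omega
  have hc := hN.cnt_le
  refine ⟨fun y hy h1 h2 => ?_, fun y hy h1 => ?_, fun y hy h1 => ?_, fun y hy h1 => ?_,
    fun a ha => ?_, fun a a' ha haa => ?_, fun a => ?_, by omega⟩
  · have h : y ≠ z := by rintro rfl; omega
    rw [Function.update_of_ne h]; exact hN.cur_leaf y (hlt y hy h) h1 h2
  · rw [slot_update hD hz hy]
    by_cases h : y = z
    · subst h; simp
    · rw [Function.update_of_ne h]
      have h3 := hN.cur_node y (hlt y hy h) h1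
      have h4 := hN.cur_ne y (hlt y hy h) (by omega)
      -- A node treated earlier cannot own the new address: its entry is its nonzero name, whereas
      -- the new address held `0`.
      rw [Function.update_of_ne (by rintro h5; rw [h5, ht] at h3; exact h4 h3.symm)]
      exact h3
  · by_cases h : y = z
    · subst h; simp
    · rw [Function.update_of_ne h]; exact hN.cur_ne y (hlt y hy h) h1
  · by_cases h : y = z
    · subst h
      simp only [Function.update_self]
      omega
    · rw [Function.update_of_ne h]; exact hN.cur_lt y (hlt y hy h) h1
  · by_cases h : a = slot X D cur z
    · exact ⟨z, le_rfl, hzM, by rw [slot_update hD hz le_rfl]; exact h⟩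
    · rw [Function.update_of_ne h] at ha
      obtain ⟨y, h1, h2, h3⟩ := hN.tab_ne a ha
      exact ⟨y, by omega, h2, by rw [slot_update hD hz (by omega)]; exact h3⟩
  · have hle := hN.tab_le
    simp only [Function.update_apply] at ha haa
    split_ifs at ha haa with h1 h2 h2
    · rw [h1, h2]
    · have := hle a'; omega
    · have := hle a; omega
    · exact hN.tab_inj a a' ha haa
  · rw [Function.update_apply]
    have := hN.tab_le a
    split_ifs <;> omega

/-- `c` holds the names of the nodes of a further tree with the leaves `bl`, or `0` where the
dictionary has no name. -/
structure Lookup (bl : ℕ → ℕ) (M X : ℕ) (tab c : ℕ → ℕ) (z : ℕ) : Prop where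
  leaf : ∀ i, z ≤ i → M ≤ i → i < 2 * M → c i = bl i
  node : ∀ i, z ≤ i → i < M → c i = tab (pairKey X i (c (2 * i)) (c (2 * i + 1)))

/-- The lookup of a node succeeds if and only if one of the copies has the same leaves below it. -/
theorem Naming.lookup_ne_zero_iff (hN : Naming leaf M D X tab cur cnt D) (hD : 0 < D)
    (hX : 2 * M * D < X) {bl c : ℕ → ℕ} (hbl : ∀ i, bl i < X) (hL : Lookup bl M X tab c 1)
    {i R : ℕ} (hi : 1 ≤ i) (hlo : M ≤ i * 2 ^ R) (hhi : (i + 1) * 2 ^ R ≤ 2 * M) (hR : R ≠ 0) :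
    c i ≠ 0 ↔ ∃ d < D, ∀ y, i * 2 ^ R ≤ y → y < (i + 1) * 2 ^ R → leaf d y = bl y := by
  have hdiv : ∀ i d, d < D → (i * D + d) / D = i := fun i d hd => by
    rw [mul_comm, Nat.mul_add_div hD, Nat.div_eq_of_lt hd, add_zero]
  have hmod : ∀ i d, d < D → (i * D + d) % D = d := fun i d hd => by
    rw [mul_comm, Nat.mul_add_mod, Nat.mod_eq_of_lt hd]
  have hge : ∀ i d, 1 ≤ i → D ≤ i * D + d := fun i d hi => by nlinarith
  have hcX : ∀ i, 1 ≤ i → i < 2 * M → c i < X := by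
    intro i h1 h2
    rcases lt_or_ge i M with h | h
    · rw [hL.node i h1 h]
      have h3 := hN.tab_le (pairKey X i (c (2 * i)) (c (2 * i + 1)))
      have h4 := hN.cnt_le
      omega
    · rw [hL.leaf i h1 h h2]; exact hbl i
  have nleaf : ∀ i d, d < D → 1 ≤ i → M ≤ i → i < 2 * M → cur (i * D + d) = leaf d i := by
    intro i d hd h1 h2 h3
    have := hN.cur_leaf (i * D + d) (hge i d h1) (by rw [hdiv i d hd]; exact h2)
      (by rw [hdiv i d hd]; exact h3)
    rwa [hdiv i d hd, hmod i d hd] at this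
  have nnode : ∀ i d, d < D → 1 ≤ i → i < M →
      tab (pairKey X i (cur (2 * i * D + d)) (cur ((2 * i + 1) * D + d))) = cur (i * D + d) := by
    intro i d hd h1 h2
    have := hN.cur_node (i * D + d) (hge i d h1) (by rw [hdiv i d hd]; exact h2)
    rwa [slot, hdiv i d hd, hmod i d hd] at this
  have nlt : ∀ i d, d < D → 1 ≤ i → i < 2 * M → cur (i * D + d) < X := fun i d hd h1 h2 =>
    hN.cur_lt _ (hge i d h1) (by rw [hdiv i d hd]; exact h2)
  have nne : ∀ i d, d < D → 1 ≤ i → i < 2 * M → cur (i * D + d) ≠ 0 := fun i d hd h1 h2 =>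
    hN.cur_ne _ (hge i d h1) (by rw [hdiv i d hd]; exact h2)
  have hlt : ∀ {i R : ℕ}, (i + 1) * 2 ^ (R + 1) ≤ 2 * M → i < M := by
    intro i R h
    have h1 : 1 ≤ 2 ^ R := Nat.one_le_two_pow
    rw [pow_succ] at h
    nlinarith
  have hlt2 : ∀ {i R : ℕ}, (i + 1) * 2 ^ R ≤ 2 * M → i < 2 * M := by
    intro i R h
    have h1 : 1 ≤ 2 ^ R := Nat.one_le_two_pow
    nlinarith
  -- Equal leaves give equal keys all the way up.
  have up : ∀ d < D, ∀ R i, 1 ≤ i → M ≤ i * 2 ^ R → (i + 1) * 2 ^ R ≤ 2 * M →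
      (∀ y, i * 2 ^ R ≤ y → y < (i + 1) * 2 ^ R → leaf d y = bl y) → c i = cur (i * D + d) := by
    intro d hd R
    induction R with
    | zero =>
      intro i h1 h2 h3 h
      simp only [pow_zero, mul_one] at h2 h3 h
      rw [hL.leaf i h1 h2 (by omega), nleaf i d hd h1 h2 (by omega), h i le_rfl (by omega)]
    | succ R ih =>
      intro i h1 h2 h3 h
      have hiM := hlt h3
      have e1 : i * 2 ^ (R + 1) = 2 * i * 2 ^ R := by ring
      have e2 : (i + 1) * 2 ^ (R + 1) = (2 * i + 1 + 1) * 2 ^ R := by ring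
      have e3 : 2 * i * 2 ^ R ≤ (2 * i + 1) * 2 ^ R := Nat.mul_le_mul_right _ (by omega)
      have e4 : (2 * i + 1) * 2 ^ R ≤ (2 * i + 1 + 1) * 2 ^ R := Nat.mul_le_mul_right _ (by omega)
      rw [e1] at h2 h
      rw [e2] at h3 h
      rw [hL.node i h1 hiM, ← nnode i d hd h1 hiM,
        ih (2 * i) (by omega) h2 (by omega) fun y hy hy' => h y hy (by omega),
        ih (2 * i + 1) (by omega) (by omega) h3 fun y hy hy' => h y (by omega) hy']
  -- Conversely, a shared nonzero name comes from a single address, and the address determines the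
  -- names of both children.
  have down : ∀ d < D, ∀ R i, 1 ≤ i → M ≤ i * 2 ^ R → (i + 1) * 2 ^ R ≤ 2 * M →
      c i = cur (i * D + d) → ∀ y, i * 2 ^ R ≤ y → y < (i + 1) * 2 ^ R → leaf d y = bl y := by
    intro d hd R
    induction R with
    | zero =>
      intro i h1 h2 h3 h y hy hy'
      simp only [pow_zero, mul_one] at h2 h3 hy hy'
      obtain rfl : y = i := by omega
      rw [← nleaf y d hd h1 h2 (by omega), ← h, hL.leaf y h1 h2 (by omega)]
    | succ R ih =>
      intro i h1 h2 h3 h y hy hy'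
      have hiM := hlt h3
      have e1 : i * 2 ^ (R + 1) = 2 * i * 2 ^ R := by ring
      have e2 : (i + 1) * 2 ^ (R + 1) = (2 * i + 1 + 1) * 2 ^ R := by ring
      have e3 : 2 * i * 2 ^ R ≤ (2 * i + 1) * 2 ^ R := Nat.mul_le_mul_right _ (by omega)
      have e4 : (2 * i + 1) * 2 ^ R ≤ (2 * i + 1 + 1) * 2 ^ R := Nat.mul_le_mul_right _ (by omega)
      rw [e1] at h2 hy
      rw [e2] at h3 hy'
      rw [hL.node i h1 hiM, ← nnode i d hd h1 hiM] at h
      have hk := hN.tab_inj _ _ (by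
        rw [h, nnode i d hd h1 hiM]; exact nne i d hd h1 (by omega)) h
      obtain ⟨-, hl, hr⟩ := pairKey_inj (hcX _ (by omega) (by omega)) (hcX _ (by omega) (by omega))
        (nlt _ d hd (by omega) (by omega)) (nlt _ d hd (by omega) (by omega)) hk
      rcases lt_or_ge y ((2 * i + 1) * 2 ^ R) with hlt | hge
      · exact ih (2 * i) (by omega) h2 (by omega) hl y hy hlt
      · exact ih (2 * i + 1) (by omega) (by omega) h3 hr y hge hy'
  constructor
  · intro hne
    obtain ⟨R, rfl⟩ := Nat.exists_eq_succ_of_ne_zero hR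
    have hiM := hlt hhi
    rw [hL.node i hi hiM] at hne
    -- A nonzero entry was written for some treated node; its key shows that this is node `i` in the
    -- copy `y % D`.
    obtain ⟨y, hy1, hy2, hy3⟩ := hN.tab_ne _ hne
    have hy4 : 1 ≤ y / D := (Nat.one_le_div_iff hD).2 hy1
    have hd := Nat.mod_lt y hD
    obtain ⟨h1, h2, h3⟩ := pairKey_inj (hcX _ (by omega) (by omega)) (hcX _ (by omega) (by omega))
      (nlt _ _ hd (by omega) (by omega)) (nlt _ _ hd (by omega) (by omega)) hy3
    refine ⟨y % D, hd, down _ hd _ i hi hlo hhi ?_⟩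
    rw [hL.node i hi hiM, h2, h3, ← h1, nnode i _ hd hi hiM]
  · rintro ⟨d, hd, h⟩
    rw [up d hd R i hi hlo hhi h]
    exact nne i d hd hi (hlt2 hhi)

/-! ### Counting the nodes without a match -/

/-- The number of nodes with `c = 0` below node `i`, down to relative depth `R`. -/
def zeros (c : ℕ → ℕ) (i R : ℕ) : ℕ :=
  ∑ r ∈ Finset.range (R + 1), ((Finset.Ico (i * 2 ^ r) ((i + 1) * 2 ^ r)).filter (c · = 0)).card

theorem card_filter_Ico_add (P : ℕ → Prop) [DecidablePred P] {a b d : ℕ} (h : a ≤ b) (h' : b ≤ d) :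
    ((Finset.Ico a d).filter P).card =
      ((Finset.Ico a b).filter P).card + ((Finset.Ico b d).filter P).card := by
  rw [← Finset.Ico_union_Ico_eq_Ico h h', Finset.filter_union, Finset.card_union_of_disjoint]
  exact Finset.disjoint_filter_filter (Finset.Ico_disjoint_Ico_consecutive a b d)

theorem zeros_succ (c : ℕ → ℕ) (i R : ℕ) :
    zeros c i (R + 1) = (if c i = 0 then 1 else 0) + zeros c (2 * i) R + zeros c (2 * i + 1) R := by
  have h : ∀ r, ((Finset.Ico (i * 2 ^ (r + 1)) ((i + 1) * 2 ^ (r + 1))).filter (c · = 0)).card =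
      ((Finset.Ico (2 * i * 2 ^ r) ((2 * i + 1) * 2 ^ r)).filter (c · = 0)).card +
      ((Finset.Ico ((2 * i + 1) * 2 ^ r) ((2 * i + 1 + 1) * 2 ^ r)).filter (c · = 0)).card := by
    intro r
    rw [show i * 2 ^ (r + 1) = 2 * i * 2 ^ r by ring,
      show (i + 1) * 2 ^ (r + 1) = (2 * i + 1 + 1) * 2 ^ r by ring]
    exact card_filter_Ico_add _ (Nat.mul_le_mul_right _ (by omega))
      (Nat.mul_le_mul_right _ (by omega))
  unfold zeros
  rw [Finset.sum_range_succ']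
  simp only [h, Finset.sum_add_distrib, pow_zero, mul_one]
  have h0 : ((Finset.Ico i (i + 1)).filter (c · = 0)).card = if c i = 0 then 1 else 0 := by
    rw [Nat.Ico_succ_singleton, Finset.filter_singleton]
    split_ifs <;> rfl
  rw [h0]; ring

theorem zeros_root (c : ℕ → ℕ) (h : ℕ) :
    zeros c 1 h = ((Finset.Ico 1 (2 * 2 ^ h)).filter (c · = 0)).card := by
  unfold zeros
  induction h with
  | zero => simp
  | succ h ih =>
    rw [Finset.sum_range_succ, ih, one_mul, pow_succ', ← card_filter_Ico_add]
    · have := Nat.one_le_two_pow (n := h); omega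
    · omega

/-- Nodes on one level have disjoint intervals, so choosing a point of `S` for each failing node is
injective there; the `h + 1` levels are added up. -/
theorem zeros_root_le {c : ℕ → ℕ} {h k : ℕ} (S : Finset ℕ)
    (hS : ∀ i R, 2 ^ h ≤ i * 2 ^ R → (i + 1) * 2 ^ R ≤ 2 * 2 ^ h → R ≤ h → c i = 0 →
      ∃ x ∈ S, (i * 2 ^ R - 2 ^ h) * k ≤ x ∧ x < ((i + 1) * 2 ^ R - 2 ^ h) * k) :
    zeros c 1 h ≤ (h + 1) * S.card := by
  unfold zeros
  rw [← smul_eq_mul, ← Finset.card_range (h + 1), ← Finset.sum_const, Finset.card_range]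
  refine Finset.sum_le_sum fun r hr => ?_
  have hr' : r ≤ h := by simpa [Nat.lt_succ_iff] using hr
  obtain ⟨R, rfl⟩ := Nat.exists_eq_add_of_le hr'
  have key : ∀ i, i ∈ (Finset.Ico (1 * 2 ^ r) ((1 + 1) * 2 ^ r)).filter (c · = 0) →
      ∃ x ∈ S, (i * 2 ^ R - 2 ^ (r + R)) * k ≤ x ∧ x < ((i + 1) * 2 ^ R - 2 ^ (r + R)) * k := by
    intro i hi
    simp only [Finset.mem_filter, Finset.mem_Ico, one_mul] at hi
    refine hS i R ?_ ?_ (by omega) hi.2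
    · rw [pow_add]; exact Nat.mul_le_mul_right _ hi.1.1
    · rw [pow_add, ← mul_assoc]; exact Nat.mul_le_mul_right _ (by omega)
  choose! f hf using key
  refine Finset.card_le_card_of_injOn f (fun i hi => (hf i hi).1) ?_
  have hlt : ∀ i j, i ∈ (Finset.Ico (1 * 2 ^ r) ((1 + 1) * 2 ^ r)).filter (c · = 0) →
      j ∈ (Finset.Ico (1 * 2 ^ r) ((1 + 1) * 2 ^ r)).filter (c · = 0) → f i = f j → j ≤ i := by
    intro i j hi hj hij
    by_contra hlt
    have h1 := (hf i hi).2.2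
    have h2 := (hf j hj).2.1
    have h3 : (i + 1) * 2 ^ R ≤ j * 2 ^ R := Nat.mul_le_mul_right _ (by omega)
    have h4 := Nat.mul_le_mul_right k (Nat.sub_le_sub_right h3 (2 ^ (r + R)))
    omega
  intro i hi j hj hij
  exact le_antisymm (hlt j i hj hi hij.symm) (hlt i j hi hj hij)

/-- If every node with `c ≠ 0` certifies that its two substrings are close, the number of the other
nodes bounds the number of edits. -/
theorem exists_edits_of_zeros {α : Type} (f g : ℕ → α) {c : ℕ → ℕ} {n k K h : ℕ} (hk : 2 * k ≤ K)
    (hc : ∀ i R a b, 2 ^ h ≤ i * 2 ^ R → (i + 1) * 2 ^ R ≤ 2 * 2 ^ h → R ≤ h → c i ≠ 0 →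
      a = min ((i * 2 ^ R - 2 ^ h) * k) n → b = min (((i + 1) * 2 ^ R - 2 ^ h) * k) n →
      ∃ r ≤ K, Edits r (seg f a (b - a)) (seg g a (b - a))) :
    ∀ R i a b, 2 ^ h ≤ i * 2 ^ R → (i + 1) * 2 ^ R ≤ 2 * 2 ^ h → R ≤ h →
      a = min ((i * 2 ^ R - 2 ^ h) * k) n → b = min (((i + 1) * 2 ^ R - 2 ^ h) * k) n →
      ∃ r ≤ (zeros c i R + 1) * K, Edits r (seg f a (b - a)) (seg g a (b - a)) := by
  intro R
  induction R with
  | zero =>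
    intro i a b h1 h2 h3 ha hb
    -- A single block has length at most `k` and is rewritten with at most `2 * k ≤ K` edits,
    -- whether it fails or not.
    refine ⟨(b - a) + (b - a), ?_, ?_⟩
    · have : b ≤ a + k := by
        simp only [pow_zero, mul_one] at h1 ha hb
        rw [show i + 1 - 2 ^ h = (i - 2 ^ h) + 1 by omega, Nat.succ_mul] at hb
        omega
      have : K ≤ (zeros c i 0 + 1) * K := Nat.le_mul_of_pos_left _ (by omega)
      omega
    · simpa using (edits_delete (seg f a (b - a))).trans (edits_insert (seg g a (b - a)))
  | succ R ih =>
    intro i a b h1 h2 h3 ha hb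
    by_cases hci : c i = 0
    · have e1 : i * 2 ^ (R + 1) = 2 * i * 2 ^ R := by ring
      have e2 : (i + 1) * 2 ^ (R + 1) = (2 * i + 1 + 1) * 2 ^ R := by ring
      have e3 : 2 * i * 2 ^ R ≤ (2 * i + 1) * 2 ^ R := Nat.mul_le_mul_right _ (by omega)
      have e4 : (2 * i + 1) * 2 ^ R ≤ (2 * i + 1 + 1) * 2 ^ R := Nat.mul_le_mul_right _ (by omega)
      have e5 := Nat.mul_le_mul_right k (Nat.sub_le_sub_right e3 (2 ^ h))
      have e6 := Nat.mul_le_mul_right k (Nat.sub_le_sub_right e4 (2 ^ h))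
      rw [e1] at h1 ha
      rw [e2] at h2 hb
      obtain ⟨m, hm⟩ : ∃ m, m = min (((2 * i + 1) * 2 ^ R - 2 ^ h) * k) n := ⟨_, rfl⟩
      obtain ⟨r, hr, hE⟩ := ih (2 * i) a m h1 (by omega) (by omega) ha hm
      obtain ⟨r', hr', hE'⟩ := ih (2 * i + 1) m b (by omega) h2 (by omega) hm hb
      refine ⟨r + r', ?_, ?_⟩
      -- The failure of `i` itself pays for the second of the two summands `1` contributed by the
      -- children.
      · rw [zeros_succ, if_pos hci]; nlinarith
      · have ham : a ≤ m := by omega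
        have hmb : m ≤ b := by omega
        have := hE.append hE'
        have e : a + (m - a) = m := by omega
        rw [← e] at this
        simp only [e] at this
        have hs : ∀ f : ℕ → α, seg f a (b - a) = seg f a (m - a) ++ seg f m (b - m) := fun f => by
          rw [show b - a = (m - a) + (b - m) by omega, seg_add, e]
        rw [hs f, hs g]
        exact this
    · obtain ⟨r, hr, hE⟩ := hc i (R + 1) a b h1 h2 h3 hci ha hb
      exact ⟨r, hr.trans (Nat.le_mul_of_pos_left _ (by omega)), hE⟩

end GapEdit

namespace WordRAM

/-! ### Repeated doubling -/

/-- Finds the least `m` with `b ≤ 2 ^ m * a`, where `a` and `b` are in registers `ra` and `rb`; puts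
`2 ^ m` into register `r` and `m` into register `q`. -/
def doubleCmd (r q ra rb : ℕ) : Cmd :=
  .seq (.assign r (.const 1)) (.seq (.assign q (.const 0))
    (.loop (.bin .lt (.bin .mul (.reg r) (.reg ra)) (.reg rb))
      (.seq (.assign r (.bin .add (.reg r) (.reg r)))
        (.assign q (.bin .add (.reg q) (.const 1))))))

/-- The least `m` with `b ≤ 2 ^ m * a`. -/
def doublings (a b : ℕ) : ℕ := sInf {m | b ≤ 2 ^ m * a}

theorem le_doublings {a : ℕ} (b : ℕ) (ha : 1 ≤ a) : b ≤ 2 ^ doublings a b * a :=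
  Nat.sInf_mem (s := {m | b ≤ 2 ^ m * a})
    ⟨b, by have := @Nat.lt_two_pow_self b; simp only [Set.mem_ofPred_eq]; nlinarith⟩

theorem lt_of_lt_doublings {a b m : ℕ} (h : m < doublings a b) : 2 ^ m * a < b := by
  have := Nat.notMem_of_lt_sInf h
  simpa using this

theorem doublings_le {a b m : ℕ} (h : b ≤ 2 ^ m * a) : doublings a b ≤ m := Nat.sInf_le h

theorem runs_doubleCmd {E : Env} {s : State} {r q ra rb a b : ℕ} (hrq : r ≠ q) (h1 : ra ≠ r)
    (h2 : ra ≠ q) (h3 : rb ≠ r) (h4 : rb ≠ q) (hra : s.reg ra = a) (hrb : s.reg rb = b)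
    (ha : 1 ≤ a) (ha' : a < 2 ^ E.w) (hb : 2 * b < 2 ^ E.w) :
    Runs E (doubleCmd r q ra rb) s (doublings a b * 14 + 10) fun s' =>
      s' = (s.setReg r (2 ^ doublings a b)).setReg q (doublings a b) := by
  have hw : 1 < 2 ^ E.w := by omega
  obtain ⟨N, hN⟩ : ∃ N, N = doublings a b := ⟨_, rfl⟩
  rw [← hN]
  -- The loop doubles only while `2 ^ j * a < b`, so `2 * b < 2 ^ w` rules out an overflow.
  have hbound : ∀ j < N, 2 ^ (j + 1) * a < 2 ^ E.w := by
    intro j hj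
    have := lt_of_lt_doublings (hN ▸ hj)
    rw [pow_succ]; nlinarith
  have hbound' : ∀ j ≤ N, 2 ^ j * a < 2 ^ E.w := by
    intro j hj
    cases j with
    | zero => simpa using ha'
    | succ j => exact hbound j hj
  refine Runs.mono (b := 2 + (2 + (N * 14 + 6)))
    (Runs.seq (Runs.assign (Runs.seq (Runs.assign ?_)))) (by omega) (fun _ h => h)
  let I : ℕ → State → Prop := fun m s' => m ≤ N ∧ s' = (s.setReg r (2 ^ (N - m))).setReg q (N - m)
  have hloop := Runs.loop (E := E) (b := 8)
    (e := .bin .lt (.bin .mul (.reg r) (.reg ra)) (.reg rb))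
    (c := .seq (.assign r (.bin .add (.reg r) (.reg r)))
        (.assign q (.bin .add (.reg q) (.const 1)))) I ?_ ?_ N
    ((s.setReg r 1).setReg q 0) ⟨le_rfl, by simp⟩
  · convert hloop.mono (b' := N * 14 + 6) (by simp [Expr.cost])
      (Q := fun s' => s' = (s.setReg r (2 ^ N)).setReg q N) ?_ using 1
    · simp [Expr.eval, Nat.mod_eq_of_lt hw]
    · rintro s' ⟨-, h⟩; simpa using h
  · rintro m s' ⟨hm, rfl⟩
    have hj : N - (m + 1) < N := by omega
    have e1 : N - m = N - (m + 1) + 1 := by omega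
    have hlt : 2 ^ (N - (m + 1)) * a < b := lt_of_lt_doublings (hN ▸ hj)
    have hb1 := hbound' _ hj.le
    have hb2 := hbound _ hj
    generalize N - (m + 1) = j at *
    have hb3 : 2 ^ j + 2 ^ j < 2 ^ E.w := by
      rw [pow_succ] at hb2; nlinarith [Nat.one_le_two_pow (n := j)]
    have hb4 : j + 1 < 2 ^ E.w := by
      have := @Nat.lt_two_pow_self j; omega
    constructor
    · simp [Expr.eval, Op.eval, State.setReg, hrq, h1, h2, h3, h4, hra,
        hrb, Nat.mod_eq_of_lt hb1, hlt]
    · refine Runs.mono (b := 4 + 4) (Runs.seq (Runs.assign (Runs.assign ?_))) le_rfl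
        (fun _ h => h)
      refine ⟨by omega, ?_⟩
      rw [e1, pow_succ, mul_two]
      simp only [Expr.eval, Op.eval, State.setReg, Function.update_apply, hrq, hrq.symm, if_true,
        if_false, Nat.mod_eq_of_lt hb3, Nat.mod_eq_of_lt hw, Nat.mod_eq_of_lt hb4]
      congr 1
      funext x
      simp only [Function.update_apply]
      split_ifs <;> simp_all
  · rintro s' ⟨-, rfl⟩
    have hb1 := hbound' N le_rfl
    have := le_doublings b ha
    rw [← hN] at this
    simp [Expr.eval, Op.eval, State.setReg, hrq, h1, h2, h3, h4, hra,
        hrb, Nat.mod_eq_of_lt hb1, this]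

end WordRAM

namespace GapEdit

open WordRAM

/-! ### The parameters of the data structure -/

/-- The parameters: `l` is the logarithm of `n`, `s` bounds the shifts, there are `2 ^ h` blocks of
length `k` and `2 ^ t` samples in every block. -/
structure Dims (w n k σ l s h t : ℕ) : Prop where
  two_le : 2 ≤ n
  k_pos : 1 ≤ k
  k_le : k ≤ n
  σ_pos : 1 ≤ σ
  l_pos : 1 ≤ l
  pow_l_le : 2 ^ l ≤ n
  lt_pow_l : n < 2 ^ (l + 1)
  s_eq : s = k / (2 * l)
  le_blocks : n ≤ 2 ^ h * k
  blocks_le : 2 ^ h * k ≤ 2 * n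
  h_le : h ≤ l + 1
  le_samples : 16 * (l + 2) ≤ 2 ^ t
  samples_le : 2 ^ t ≤ 32 * (l + 2)
  word : 50000000 * (n * n * n * n * n * n) * ((σ + 2) * (σ + 2)) ≤ 2 ^ w

/-- The bound on the names. -/
def nameBound (n σ : ℕ) : ℕ := 600 * n * n * (σ + 2)

/-- The least `m` with `n < 2 ^ m` is one more than the integer part of `log n`. -/
def logParam (n : ℕ) : ℕ := doublings 1 (n + 1) - 1
def shiftParam (n k : ℕ) : ℕ := k / (2 * logParam n)
def blockParam (n k : ℕ) : ℕ := doublings k n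
def sampleParam (n : ℕ) : ℕ := doublings 1 (16 * (logParam n + 2))

theorem logParam_spec {n : ℕ} (hn : 2 ≤ n) :
    1 ≤ logParam n ∧ 2 ^ logParam n ≤ n ∧ n < 2 ^ (logParam n + 1) ∧
      doublings 1 (n + 1) = logParam n + 1 := by
  have h1 := le_doublings (a := 1) (n + 1) le_rfl
  have h2 : 2 ≤ doublings 1 (n + 1) := by
    by_contra h
    have : 2 ^ doublings 1 (n + 1) ≤ 2 ^ 1 := Nat.pow_le_pow_right (by norm_num) (by omega)
    omega
  unfold logParam
  have h3 := lt_of_lt_doublings (a := 1) (b := n + 1) (m := doublings 1 (n + 1) - 1) (by omega)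
  rw [Nat.sub_add_cancel (by omega)]
  exact ⟨by omega, by omega, by omega, rfl⟩

theorem dims_params {n k σ : ℕ} (hn : 2 ≤ n) (hk : 1 ≤ k) (hkn : k ≤ n) (hσ : 1 ≤ σ) :
    Dims (wordSize 20 n σ) n k σ (logParam n) (shiftParam n k) (blockParam n k)
      (sampleParam n) := by
  obtain ⟨h1, h2, h3, -⟩ := logParam_spec hn
  refine ⟨hn, hk, hkn, hσ, h1, h2, h3, rfl, le_doublings _ hk, ?_, ?_, ?_, ?_, ?_⟩
  · unfold blockParam
    rcases Nat.eq_zero_or_pos (doublings k n) with h | h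
    · rw [h]; omega
    · obtain ⟨m, hm⟩ := Nat.exists_eq_succ_of_ne_zero h.ne'
      have := lt_of_lt_doublings (a := k) (b := n) (m := m) (by omega)
      rw [hm, pow_succ]; nlinarith
  · exact doublings_le (by nlinarith)
  · simpa [sampleParam] using le_doublings (a := 1) (16 * (logParam n + 2)) le_rfl
  · unfold sampleParam
    rcases Nat.eq_zero_or_pos (doublings 1 (16 * (logParam n + 2))) with h | h
    · rw [h]; omega
    · obtain ⟨m, hm⟩ := Nat.exists_eq_succ_of_ne_zero h.ne'
      have := lt_of_lt_doublings (a := 1) (b := 16 * (logParam n + 2)) (m := m) (by omega)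
      rw [hm, pow_succ]; omega
  · unfold wordSize
    have hn1 : n ≤ 2 ^ n.size := n.lt_size_self.le
    have hσ1 : σ < 2 ^ σ.size := σ.lt_size_self
    have hb : 1 ≤ σ.size := Nat.size_pos.2 hσ
    have ha : 2 ≤ n.size := Nat.lt_size.2 (by omega)
    have hσ2 : σ + 2 ≤ 2 ^ (2 * σ.size) := by
      rw [two_mul, pow_add]
      have : 2 ^ 1 ≤ 2 ^ σ.size := Nat.pow_le_pow_right (by norm_num) hb
      nlinarith
    calc 50000000 * (n * n * n * n * n * n) * ((σ + 2) * (σ + 2))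
        ≤ 2 ^ (13 * n.size) * (2 ^ n.size * 2 ^ n.size * 2 ^ n.size * 2 ^ n.size * 2 ^ n.size *
            2 ^ n.size) * (2 ^ (2 * σ.size) * 2 ^ (2 * σ.size)) := by
          -- As `n ≥ 2` has at least two binary digits, the exponent is at least `26`, and `2 ^ 26`
          -- exceeds the constant.
          have : 50000000 ≤ 2 ^ (13 * n.size) :=
            le_trans (by norm_num) (Nat.pow_le_pow_right (n := 2) (by norm_num)
              (show 26 ≤ 13 * n.size by omega))
          gcongr
      _ = 2 ^ (19 * n.size + 4 * σ.size) := by ring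
      _ ≤ _ := Nat.pow_le_pow_right (by norm_num) (by omega)

variable {w n k σ l s h t : ℕ}

/-! ### Numerical consequences of the choice of parameters. -/

namespace Dims

theorem l_lt (hd : Dims w n k σ l s h t) : l < n :=
  lt_of_lt_of_le Nat.lt_two_pow_self hd.pow_l_le

theorem s_mul_le (hd : Dims w n k σ l s h t) : s * (2 * l) ≤ k := by
  rw [hd.s_eq]; exact Nat.div_mul_le_self k (2 * l)

theorem two_s_le (hd : Dims w n k σ l s h t) : 2 * s ≤ k := by
  have := hd.s_mul_le; have := hd.l_pos; nlinarith

/-- Blocks times shifts: `2 * s + 1 ≤ 2 * k` cancels the block length. This makes the preprocessing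
nearly linear. -/
theorem shifts_le (hd : Dims w n k σ l s h t) : 2 ^ h * (2 * s + 1) ≤ 4 * n := by
  have h1 := hd.two_s_le; have h2 := hd.blocks_le; have h3 := hd.k_pos
  nlinarith [Nat.one_le_two_pow (n := h)]

theorem blocks_le' (hd : Dims w n k σ l s h t) : 2 ^ h ≤ 2 * n := by
  have h2 := hd.blocks_le; have h3 := hd.k_pos
  nlinarith [Nat.one_le_two_pow (n := h)]

theorem samples_le' (hd : Dims w n k σ l s h t) : 2 ^ t ≤ 64 * n := by
  have := hd.samples_le; have := hd.l_lt; have := hd.two_le; omega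

theorem leaves_le (hd : Dims w n k σ l s h t) : 2 ^ h * 2 ^ t ≤ 128 * (n * n) := by
  calc 2 ^ h * 2 ^ t ≤ (2 * n) * (64 * n) := Nat.mul_le_mul hd.blocks_le' hd.samples_le'
    _ = _ := by ring

theorem nodes_le (hd : Dims w n k σ l s h t) :
    2 * (2 ^ h * 2 ^ t) * (2 * s + 1) ≤ 512 * (n * n) := by
  calc 2 * (2 ^ h * 2 ^ t) * (2 * s + 1) = 2 * (2 ^ h * (2 * s + 1)) * 2 ^ t := by ring
    _ ≤ 2 * (4 * n) * (64 * n) :=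
      Nat.mul_le_mul (Nat.mul_le_mul_left _ hd.shifts_le) hd.samples_le'
    _ = _ := by ring

/-- One bound dominates the numbers of nodes, the symbol codes, the sample positions and the small
constants in the programs. -/
theorem le_nameBound (hd : Dims w n k σ l s h t) :
    600 * (n * n) + 2 * σ + 200 ≤ nameBound n σ := by
  have h1 : 4 ≤ n * n := by have := hd.two_le; nlinarith
  have h2 : nameBound n σ = 600 * (n * n) * (σ + 2) := by unfold nameBound; ring
  rw [h2]; nlinarith

theorem nodes_lt (hd : Dims w n k σ l s h t) :
    2 * (2 ^ h * 2 ^ t) * (2 * s + 1) < nameBound n σ := by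
  have := hd.nodes_le; have := hd.le_nameBound; omega

/-- Every key fits in a word and can serve as an address, so no hashing is needed. The constant is
`128 * 600 ^ 2 = 46080000`. -/
theorem keys_le (hd : Dims w n k σ l s h t) :
    2 ^ h * 2 ^ t * nameBound n σ * nameBound n σ ≤ 2 ^ w := by
  calc 2 ^ h * 2 ^ t * nameBound n σ * nameBound n σ
      ≤ 128 * (n * n) * nameBound n σ * nameBound n σ := by
        exact Nat.mul_le_mul_right _ (Nat.mul_le_mul_right _ hd.leaves_le)
    _ = 46080000 * (n * n * n * n * n * n) * ((σ + 2) * (σ + 2)) := by unfold nameBound; ring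
    _ ≤ _ := le_trans (by gcongr; norm_num) hd.word

theorem nameBound_lt (hd : Dims w n k σ l s h t) : nameBound n σ < 2 ^ w := by
  have h1 := hd.keys_le
  have h2 := hd.le_nameBound
  have h3 : 1 ≤ 2 ^ h * 2 ^ t := Nat.mul_pos (by positivity) (by positivity)
  have h4 : nameBound n σ ≤ 2 ^ h * 2 ^ t * nameBound n σ := Nat.le_mul_of_pos_left _ h3
  nlinarith

end Dims

end GapEdit

/-! ### Straight-line blocks and the effect of updates on a state. -/

namespace WordRAM

/-- Commands one after the other. -/
def block : List Cmd → Cmd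
  | [] => .skip
  | c :: cs => .seq c (block cs)

section

variable {E : Env} {s : State} {Q : State → Prop} {b b' : ℕ}

theorem Runs.cons {c : Cmd} {cs : List Cmd}
    (h : Runs E c s b fun s' => Runs E (block cs) s' b' Q) :
    Runs E (block (c :: cs)) s (b + b') Q := Runs.seq h

theorem Runs.nil (h : Q s) : Runs E (block []) s 1 Q := Runs.skip h

theorem Runs.assign_eq {r : ℕ} {e : Expr} (v : ℕ) (hv : e.eval E s = v) (h : Q (s.setReg r v)) :
    Runs E (.assign r e) s (e.cost + 1) Q := Runs.assign (by rwa [hv])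

theorem Runs.store_eq {arr : ℕ} {a e : Expr} (x v : ℕ) (hx : a.eval E s = x) (hv : e.eval E s = v)
    (h : Q (s.setMem arr x v)) :
    Runs E (.store arr a e) s (a.cost + e.cost + 1) Q := Runs.store (by rwa [hx, hv])

end

@[simp] theorem State.setReg_reg (s : State) (r v x : ℕ) :
    (s.setReg r v).reg x = if x = r then v else s.reg x := by
  simp [State.setReg, Function.update_apply]

@[simp] theorem State.setReg_mem (s : State) (r v : ℕ) : (s.setReg r v).mem = s.mem := rfl

@[simp] theorem State.setReg_pos (s : State) (r v : ℕ) : (s.setReg r v).pos = s.pos := rfl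

@[simp] theorem State.setMem_reg (s : State) (a i v : ℕ) : (s.setMem a i v).reg = s.reg := rfl

@[simp] theorem State.setMem_pos (s : State) (a i v : ℕ) : (s.setMem a i v).pos = s.pos := rfl

@[simp] theorem State.setMem_mem (s : State) (a i v b : ℕ) :
    (s.setMem a i v).mem b = if b = a then Function.update (s.mem a) i v else s.mem b := by
  simp [State.setMem, Function.update_apply]

end WordRAM

namespace GapEdit

open WordRAM

/-! ### The programs -/

/-- Computes the parameters. -/
def setupCmd : Cmd := block [
  .assign 13 (.const 1),
  .assign 14 (.bin .add (.reg 0) (.const 1)),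
  doubleCmd 5 4 13 14,
  .assign 4 (.bin .sub (.reg 4) (.const 1)),
  .assign 6 (.bin .div (.reg 1) (.bin .mul (.const 2) (.reg 4))),
  doubleCmd 7 5 1 0,
  .assign 14 (.bin .mul (.const 16) (.bin .add (.reg 4) (.const 2))),
  doubleCmd 8 5 13 14,
  .assign 9 (.bin .mul (.reg 7) (.reg 8)),
  .assign 10 (.bin .mul (.bin .mul (.bin .mul (.const 600) (.reg 0)) (.reg 0))
    (.bin .add (.reg 2) (.const 2))),
  .assign 11 (.bin .add (.bin .mul (.const 2) (.reg 6)) (.const 1))]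

/-- The parameters have been computed. -/
structure Ready (n k σ l s h t : ℕ) (st : State) : Prop where
  r0 : st.reg 0 = n
  r1 : st.reg 1 = k
  r4 : st.reg 4 = l
  r6 : st.reg 6 = s
  r7 : st.reg 7 = 2 ^ h
  r8 : st.reg 8 = 2 ^ t
  r9 : st.reg 9 = 2 ^ h * 2 ^ t
  r10 : st.reg 10 = nameBound n σ
  r11 : st.reg 11 = 2 * s + 1

variable {n k σ l s h t : ℕ} {st : State}

theorem Ready.congr {st' : State} (hr : Ready n k σ l s h t st)
    (h' : ∀ r ≤ 11, st'.reg r = st.reg r) : Ready n k σ l s h t st' := by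
  constructor <;> rw [h' _ (by norm_num)]
  exacts [hr.r0, hr.r1, hr.r4, hr.r6, hr.r7, hr.r8, hr.r9, hr.r10, hr.r11]

theorem runs_setupCmd {E : Env} (hd : Dims E.w n k σ (logParam n) (shiftParam n k) (blockParam n k)
      (sampleParam n)) (h0 : st.reg 0 = n) (h1 : st.reg 1 = k) (h2 : st.reg 2 = σ) :
    Runs E setupCmd st (1500 * logParam n) fun st' =>
      Ready n k σ (logParam n) (shiftParam n k) (blockParam n k) (sampleParam n) st' ∧
        st'.mem = st.mem ∧ st'.pos = st.pos := by
  obtain ⟨hl1, -, -, hl⟩ := logParam_spec hd.two_le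
  have hX := hd.le_nameBound
  have hXw := hd.nameBound_lt
  have hs := hd.two_s_le
  have hnn : n ≤ n * n := Nat.le_mul_self n
  have hn := hd.two_le
  have hk := hd.k_pos
  have hkn := hd.k_le
  have hln := hd.l_lt
  have hM := hd.leaves_le
  have ht : sampleParam n ≤ 32 * (logParam n + 2) := Nat.lt_two_pow_self.le.trans hd.samples_le
  have hh := hd.h_le
  -- The intermediate values stay below the word bound, so the reductions modulo `2 ^ w` disappear.
  have hc : ∀ x ≤ 1000, x % 2 ^ E.w = x := fun x hx => Nat.mod_eq_of_lt (by omega)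
  have hm : ∀ x ≤ nameBound n σ, x % 2 ^ E.w = x := fun x hx => Nat.mod_eq_of_lt (by omega)
  have hX1 : 600 * n ≤ nameBound n σ := by omega
  have hX2 : 600 * n * n ≤ nameBound n σ := by rw [mul_assoc]; omega
  refine Runs.mono (b := 2 + (4 + (doublings 1 (n + 1) * 14 + 10 + (4 + (6 +
      (doublings k n * 14 + 10 + (6 + (doublings 1 (16 * (logParam n + 2)) * 14 + 10 +
      (4 + (10 + (6 + 1))))))))))) (Runs.cons <| Runs.assign_eq 1 ?_ <|
    Runs.cons <| Runs.assign_eq (n + 1) ?_ <|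
    Runs.cons <| (runs_doubleCmd (r := 5) (q := 4) (ra := 13) (rb := 14)
        (a := 1) (b := n + 1) (by norm_num) (by norm_num) (by norm_num)
      (by norm_num) (by norm_num) ?_ ?_ ?_ ?_ ?_).mono le_rfl ?_) ?_ (fun _ h => h)
  rotate_left 7
  · intro s3 hs3
    refine Runs.cons <| Runs.assign_eq (logParam n) ?_ <|
      Runs.cons <| Runs.assign_eq (shiftParam n k) ?_ <|
      Runs.cons <| (runs_doubleCmd (r := 7) (q := 5) (ra := 1) (rb := 0)
        (a := k) (b := n) (by norm_num) (by norm_num) (by norm_num)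
        (by norm_num) (by norm_num) ?_ ?_ ?_ ?_ ?_).mono le_rfl ?_
    rotate_left 7
    · intro s6 hs6
      refine Runs.cons <| Runs.assign_eq (16 * (logParam n + 2)) ?_ <|
        Runs.cons <| (runs_doubleCmd (r := 8) (q := 5) (ra := 13) (rb := 14)
        (a := 1) (b := 16 * (logParam n + 2)) (by norm_num)
          (by norm_num) (by norm_num) (by norm_num) (by norm_num) ?_ ?_ ?_ ?_ ?_).mono le_rfl ?_
      rotate_left 6
      · intro s8 hs8
        refine Runs.cons <| Runs.assign_eq (2 ^ blockParam n k * 2 ^ sampleParam n) ?_ <|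
          Runs.cons <| Runs.assign_eq (nameBound n σ) ?_ <|
          Runs.cons <| Runs.assign_eq (2 * shiftParam n k + 1) ?_ <| Runs.nil ?_
        · subst hs8 hs6
          simp [Expr.eval, Op.eval, blockParam, sampleParam]
          exact hm _ (by unfold blockParam sampleParam at hM; omega)
        · subst hs8 hs6 hs3
          simp [Expr.eval, Op.eval, h0, h2, hc, hm (600 * n) hX1, hm (600 * n * n) hX2,
            hm (σ + 2) (by omega)]
          exact hm _ le_rfl
        · subst hs8 hs6 hs3
          simp [Expr.eval, Op.eval, hc, hm (2 * shiftParam n k) (by omega)]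
          exact hm _ (by omega)
        · subst hs8 hs6 hs3
          refine ⟨⟨?_, ?_, ?_, ?_, ?_, ?_, ?_, ?_, ?_⟩, rfl, rfl⟩ <;>
            simp [h0, h1, blockParam, sampleParam]
      · subst hs6 hs3
        simp [Expr.eval, Op.eval, hc, hm (logParam n + 2) (by omega)]
        exact hm _ (by omega)
      · subst hs6 hs3; simp
      · simp
      · norm_num
      · omega
      · omega
    · subst hs3; simp [Expr.eval, Op.eval, hc, hl]
    · subst hs3
      simp [Expr.eval, Op.eval, hc, h1, shiftParam, hm (2 * logParam n) (by omega)]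
    · subst hs3; simp [h1]
    · subst hs3; simp [h0]
    · exact hk
    · omega
    · omega
  · simp only [hl]
    unfold blockParam at hh
    unfold sampleParam at ht
    omega
  · simp [Expr.eval, hc]
  · simp [Expr.eval, Op.eval, h0, hc, hm (n + 1) (by omega)]
  · simp
  · simp
  · norm_num
  · omega
  · omega

/-- Draws the positions of the samples. -/
def sampleCmd : Cmd := block [
  .assign 12 (.const 0),
  .loop (.bin .lt (.reg 12) (.reg 9)) (block [
    .rand 13,
    .store 0 (.reg 12) (.bin .add (.bin .mul (.bin .div (.reg 12) (.reg 8)) (.reg 1))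
      (.bin .mod (.reg 13) (.reg 1))),
    .assign 12 (.bin .add (.reg 12) (.const 1))])]

/-- The position of sample `j`. -/
def samplePos (k t : ℕ) (tape : ℕ → ℕ) (j : ℕ) : ℕ := j / 2 ^ t * k + tape j % k

/-- The blocks may overshoot `n`, but by at most a factor `2`; out of range, both strings read as
`0`. -/
theorem Dims.samplePos_lt {w : ℕ} (hd : Dims w n k σ l s h t) (tape : ℕ → ℕ) {j : ℕ}
    (hj : j < 2 ^ h * 2 ^ t) : samplePos k t tape j < 2 * n := by
  have h1 : j / 2 ^ t < 2 ^ h := (Nat.div_lt_iff_lt_mul (by positivity)).2 hj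
  have h2 := Nat.mod_lt (tape j) hd.k_pos
  have h3 := hd.blocks_le
  have h4 : (j / 2 ^ t + 1) * k ≤ 2 ^ h * k := Nat.mul_le_mul_right _ h1
  unfold samplePos
  rw [Nat.succ_mul] at h4
  omega

theorem runs_sampleCmd {E : Env} (hd : Dims E.w n k σ l s h t) (hr : Ready n k σ l s h t st)
    (hpos : st.pos = 0) :
    Runs E sampleCmd st (30 * (2 ^ h * 2 ^ t) + 10) fun st' => Ready n k σ l s h t st' ∧
      (∀ j < 2 ^ h * 2 ^ t, st'.mem 0 j = samplePos k t E.tape j) ∧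
      ∀ a ≠ 0, st'.mem a = st.mem a := by
  have hX := hd.le_nameBound
  have hXw := hd.nameBound_lt
  have hnn : n ≤ n * n := Nat.le_mul_self n
  have hM := hd.leaves_le
  obtain ⟨M, hMdef⟩ : ∃ M, M = 2 ^ h * 2 ^ t := ⟨_, rfl⟩
  rw [← hMdef] at hM ⊢
  -- The number of words drawn equals the loop counter, so sample `j` uses word `j` of the tape, and
  -- distinct samples are independent.
  let I : ℕ → State → Prop := fun m st' => m ≤ M ∧ Ready n k σ l s h t st' ∧ st'.reg 12 = M - m ∧
    st'.pos = M - m ∧ (∀ j < M - m, st'.mem 0 j = samplePos k t E.tape j) ∧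
    ∀ a ≠ 0, st'.mem a = st.mem a
  refine Runs.mono (b := 2 + ((M * (3 + 1 + 17) + (3 + 1)) + 1))
    (Runs.cons <| Runs.assign_eq 0 (by simp [Expr.eval]) <|
    Runs.cons <| (Runs.loop (e := .bin .lt (.reg 12) (.reg 9)) I ?_ ?_ M _ ?_).mono le_rfl ?_)
    (by omega) (fun _ h => h)
  · rintro m s' ⟨hm, hR, h12, hp, hP, ha⟩
    have hj : M - (m + 1) < M := by omega
    have e1 : M - m = M - (m + 1) + 1 := by omega
    generalize hjd : M - (m + 1) = j at *
    have hlt := hd.samplePos_lt E.tape (j := j) (by rw [← hMdef]; exact hj)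
    constructor
    · simp [Expr.eval, Op.eval, h12, hR.r9, ← hMdef, hj]
    refine Runs.mono (b := 1 + (11 + (4 + 1))) (Runs.cons <| Runs.rand <|
      Runs.cons <| Runs.store_eq j (samplePos k t E.tape j) ?_ ?_ <|
      Runs.cons <| Runs.assign_eq (j + 1) ?_ <| Runs.nil ?_) (by omega) (fun _ h => h)
    · simp [Expr.eval, h12]
    · have hlt' : j / 2 ^ t * k < 2 ^ E.w := by
        unfold samplePos at hlt; omega
      simp [Expr.eval, Op.eval, h12, hR.r8, hR.r1, hp, Nat.mod_eq_of_lt hlt']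
      exact Nat.mod_eq_of_lt (by unfold samplePos at hlt; omega)
    · have h1 : 1 % 2 ^ E.w = 1 := Nat.mod_eq_of_lt (by omega)
      simp [Expr.eval, Op.eval, h12, h1]
      exact Nat.mod_eq_of_lt (by omega)
    · refine ⟨by omega, ?_, ?_, ?_, ?_, ?_⟩
      · refine hR.congr fun r hr => ?_
        simp [show r ≠ 12 by omega, show r ≠ 13 by omega]
      · simp [e1]
      · simp [e1, hp]
      · intro i hi
        rw [e1] at hi
        simp only [State.setReg_mem, State.setMem_mem, if_true, Function.update_apply]
        split_ifs with hij
        · rw [hij]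
        · exact hP i (by omega)
      · intro a ha0
        simp [ha0, ha a ha0]
  · rintro s' ⟨-, hR, h12, -⟩
    simp [Expr.eval, Op.eval, h12, hR.r9, ← hMdef]
  · refine ⟨le_rfl, hr.congr fun r hr => ?_, by simp, by simp [hpos], by simp, by simp⟩
    simp [show r ≠ 12 by omega]
  · rintro s' ⟨-, hR, -, -, hP, ha⟩
    exact Runs.nil ⟨hR, by simpa using hP, ha⟩


/-- The code of the symbol that is compared with position `p` under the shift `d - s`. -/
def shiftSym (a : ℕ → ℕ) (s d p : ℕ) : ℕ := if p + d < s then 1 else 1 + a (p + d - s)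

/-- Names the inner node in register `13` of the copy in register `14`. -/
def nameNode : Cmd := block [
  .assign 16 (.bin .add (.bin .mul (.bin .add (.bin .mul (.reg 13) (.reg 10))
    (.load 2 (.bin .add (.bin .mul (.bin .mul (.const 2) (.reg 13)) (.reg 11)) (.reg 14))))
    (.reg 10))
    (.load 2 (.bin .add (.bin .mul (.bin .add (.bin .mul (.const 2) (.reg 13)) (.const 1))
      (.reg 11)) (.reg 14)))),
  -- An entry `0` means that the pair has no name yet.
  .branch (.load 1 (.reg 16)) .skip
    (block [.assign 15 (.bin .add (.reg 15) (.const 1)), .store 1 (.reg 16) (.reg 15)]),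
  .store 2 (.reg 12) (.load 1 (.reg 16))]

/-- Names the leaf in register `13` of the copy in register `14`. -/
def nameLeaf : Cmd := block [
  .assign 16 (.bin .add (.load 0 (.bin .sub (.reg 13) (.reg 9))) (.reg 14)),
  .store 2 (.reg 12) (.bin .add (.const 1)
    -- The factor is `0` left of the string, where truncated subtraction would wrongly read position
    -- `0`. Adding `1` keeps the names of leaves nonzero.
    (.bin .mul (.bin .sub (.const 1) (.bin .lt (.reg 16) (.reg 6)))
      (.inA (.bin .sub (.reg 16) (.reg 6)))))]

def nameStep : Cmd := block [
  .assign 12 (.bin .sub (.reg 12) (.const 1)),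
  .assign 13 (.bin .div (.reg 12) (.reg 11)),
  .assign 14 (.bin .mod (.reg 12) (.reg 11)),
  .branch (.bin .lt (.reg 13) (.reg 9)) nameNode nameLeaf]

/-- Names the nodes of the trees of all shifts. -/
def nameCmd : Cmd := block [
  .assign 12 (.bin .mul (.bin .mul (.const 2) (.reg 9)) (.reg 11)),
  .assign 15 (.const 0),
  .loop (.bin .lt (.reg 11) (.reg 12)) nameStep]

/-! ### Correctness and cost of the naming program. -/

section

variable {E : Env} {leaf : ℕ → ℕ → ℕ} {M D X z cnt : ℕ} {st : State}

theorem runs_nameNode (h10 : st.reg 10 = X)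
    (h11 : st.reg 11 = D) (h12 : st.reg 12 = z) (h13 : st.reg 13 = z / D)
    (h14 : st.reg 14 = z % D) (hzM : z / D < M) (hD : 0 < D) (hz : D ≤ z) (hX : 2 * M * D < X)
    (hXw : X < 2 ^ E.w) (hkeys : M * X * X ≤ 2 ^ E.w)
    (hN : Naming leaf M D X (st.mem 1) (st.mem 2) (st.reg 15) (z + 1)) :
    Runs E nameNode st 42 fun st' => (∀ r ≤ 12, st'.reg r = st.reg r) ∧ st'.mem 0 = st.mem 0 ∧
      Naming leaf M D X (st'.mem 1) (st'.mem 2) (st'.reg 15) z := by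
  have hM : 2 * M ≤ 2 * M * D := Nat.le_mul_of_pos_right _ hD
  have hc : ∀ x ≤ X, x % 2 ^ E.w = x := fun x hx => Nat.mod_eq_of_lt (by omega)
  have hmod := Nat.mod_lt z hD
  obtain ⟨hch1, hch2⟩ := lt_child hD hz
  obtain ⟨hdv1, hdv2⟩ := child_div (y := z) hD
  have hl := hN.cur_lt _ hch1 (by rw [hdv1]; omega)
  have hr := hN.cur_lt _ hch2 (by rw [hdv2]; omega)
  have hkey := pairKey_lt hzM hl hr
  have hlt1 : 2 * (z / D) * D + z % D < 2 * M * D := by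
    have := (Nat.div_lt_iff_lt_mul hD).1 (show (2 * (z / D) * D + z % D) / D < 2 * M by omega)
    exact this
  have hlt2 : (2 * (z / D) + 1) * D + z % D < 2 * M * D :=
    (Nat.div_lt_iff_lt_mul hD).1 (show ((2 * (z / D) + 1) * D + z % D) / D < 2 * M by omega)
  have hslot : slot X D (st.mem 2) z < 2 ^ E.w := lt_of_lt_of_le hkey hkeys
  have hcnt := hN.cnt_le
  have hX1 : 1 < X := by omega
  refine Runs.mono (b := 26 + (11 + (4 + 1))) (Runs.cons <| Runs.assign_eq (slot X D (st.mem 2) z)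
    ?_ <| Runs.cons <| Runs.branch (b := 8) ?_ ?_) le_rfl (fun _ h => h)
  · have e1 : 2 % 2 ^ E.w = 2 := hc 2 (by omega)
    have e1' : 1 % 2 ^ E.w = 1 := hc 1 (by omega)
    have e2 := hc (2 * (z / D)) (by omega)
    have e3 := hc (2 * (z / D) * D) (by omega)
    have e4 := hc (2 * (z / D) * D + z % D) (by omega)
    have e5 := hc (2 * (z / D) + 1) (by omega)
    have e6 := hc ((2 * (z / D) + 1) * D) (by omega)
    have e7 := hc ((2 * (z / D) + 1) * D + z % D) (by omega)
    unfold slot pairKey at hslot ⊢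
    have hle : ∀ a b, a ≤ a * X + b := fun a b => by nlinarith
    simp only [Expr.eval, Op.eval, h10, h11, h13, h14, e1, e1', e2, e3, e4, e5, e6, e7]
    generalize st.mem 2 (2 * (z / D) * D + z % D) = u at *
    generalize st.mem 2 ((2 * (z / D) + 1) * D + z % D) = v at *
    have b1 := hle (z / D * X + u) v
    rw [Nat.mod_eq_of_lt (a := z / D * X) (by omega), Nat.mod_eq_of_lt (a := z / D * X + u)
      (by omega), Nat.mod_eq_of_lt (a := (z / D * X + u) * X) (by omega), Nat.mod_eq_of_lt hslot]
  · intro hne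
    simp only [Expr.eval, State.setReg_reg, State.setReg_mem, if_true] at hne
    refine (Runs.skip (Runs.cons <| Runs.store_eq z (st.mem 1 (slot X D (st.mem 2) z))
      (by simp [Expr.eval, h12]) (by simp [Expr.eval]) <| Runs.nil ⟨fun r hr => ?_, by simp, ?_⟩)).mono
      (by omega) (fun _ h => h)
    · simp [show r ≠ 16 by omega]
    · simpa using hN.step_old hD hz hzM hX hne
  · intro heq
    simp only [Expr.eval, State.setReg_reg, State.setReg_mem, if_true] at heq
    refine Runs.cons <| Runs.assign_eq (st.reg 15 + 1) ?_ <| Runs.cons <|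
      Runs.store_eq (slot X D (st.mem 2) z) (st.reg 15 + 1) (by simp [Expr.eval])
        (by simp [Expr.eval]) <| Runs.nil <| Runs.cons <| Runs.store_eq z (st.reg 15 + 1)
      (by simp [Expr.eval, h12]) (by simp [Expr.eval]) <| Runs.nil ⟨fun r hr => ?_, by simp, ?_⟩
    · simp [Expr.eval, Op.eval, hc 1 (by omega)]
      exact hc _ (by omega)
    · simp [show r ≠ 16 by omega, show r ≠ 15 by omega]
    · simpa using hN.step_new hD hz hzM hX heq

theorem runs_nameLeaf {P : ℕ → ℕ} {s σ : ℕ} (h6 : st.reg 6 = s) (h9 : st.reg 9 = M)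
    (h12 : st.reg 12 = z) (h13 : st.reg 13 = z / D) (h14 : st.reg 14 = z % D) (hzM : M ≤ z / D)
    (hzM' : z / D < 2 * M) (hD : 0 < D) (hz : D ≤ z)
    (hXw : X < 2 ^ E.w) (hP : ∀ j < M, P j + D < X) (hA : ∀ i, E.strA i ≤ σ) (hσ : σ + 1 < X)
    (h0 : ∀ j < M, st.mem 0 j = P j)
    (hN : Naming (fun d y => shiftSym E.strA s d (P (y - M))) M D X (st.mem 1) (st.mem 2)
      (st.reg 15) (z + 1)) :
    Runs E nameLeaf st 22 fun st' => (∀ r ≤ 12, st'.reg r = st.reg r) ∧ st'.mem 0 = st.mem 0 ∧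
      Naming (fun d y => shiftSym E.strA s d (P (y - M))) M D X (st'.mem 1) (st'.mem 2)
        (st'.reg 15) z := by
  have hc : ∀ x ≤ X, x % 2 ^ E.w = x := fun x hx => Nat.mod_eq_of_lt (by omega)
  have hmod := Nat.mod_lt z hD
  have hj : z / D - M < M := by omega
  have hPj := hP _ hj
  have hsym : shiftSym E.strA s (z % D) (P (z / D - M)) ≤ σ + 1 := by
    unfold shiftSym
    have := hA (P (z / D - M) + z % D - s)
    split_ifs <;> omega
  refine Runs.mono (b := 7 + (14 + 1)) (Runs.cons <|
    Runs.assign_eq (P (z / D - M) + z % D) ?_ <| Runs.cons <|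
    Runs.store_eq z (shiftSym E.strA s (z % D) (P (z / D - M))) ?_ ?_ <|
    Runs.nil ⟨fun r hr => ?_, by simp, ?_⟩) le_rfl (fun _ h => h)
  · simp only [Expr.eval, Op.eval, h9, h13, h14, h0 _ hj]
    exact hc _ (by omega)
  · simp [Expr.eval, h12]
  · have hA' := hA (P (z / D - M) + z % D - s)
    simp only [Expr.eval, Op.eval, State.setReg_reg, if_true, hc 1 (by omega), shiftSym,
      show (6 : ℕ) ≠ 16 by norm_num, if_false, h6]
    split_ifs
    · simp [hc 1 (by omega)]
    · rw [Nat.sub_zero, one_mul, hc (E.strA (P (z / D - M) + z % D - s)) (by omega),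
        hc (1 + E.strA (P (z / D - M) + z % D - s)) (by omega)]
  · simp [show r ≠ 16 by omega]
  · have := hN.step_leaf hD hz hzM (v := shiftSym E.strA s (z % D) (P (z / D - M))) rfl
      (by unfold shiftSym; split_ifs <;> omega) (by omega)
    simpa using this

theorem runs_nameStep {P : ℕ → ℕ} {s σ : ℕ} (h6 : st.reg 6 = s) (h9 : st.reg 9 = M)
    (h10 : st.reg 10 = X) (h11 : st.reg 11 = D) (h12 : st.reg 12 = z + 1) (hD : 0 < D) (hz : D ≤ z)
    (hz' : z < 2 * M * D) (hX : 2 * M * D < X)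
    (hXw : X < 2 ^ E.w) (hkeys : M * X * X ≤ 2 ^ E.w)
    (hP : ∀ j < M, P j + D < X) (hA : ∀ i, E.strA i ≤ σ) (hσ : σ + 1 < X)
    (h0 : ∀ j < M, st.mem 0 j = P j)
    (hN : Naming (fun d y => shiftSym E.strA s d (P (y - M))) M D X (st.mem 1) (st.mem 2)
      (st.reg 15) (z + 1)) :
    Runs E nameStep st 59 fun st' => (∀ r ≤ 11, st'.reg r = st.reg r) ∧ st'.reg 12 = z ∧
      st'.mem 0 = st.mem 0 ∧
      Naming (fun d y => shiftSym E.strA s d (P (y - M))) M D X (st'.mem 1) (st'.mem 2)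
        (st'.reg 15) z := by
  have h1 : 1 % 2 ^ E.w = 1 := Nat.mod_eq_of_lt (by omega)
  have hdiv : z / D < 2 * M := (Nat.div_lt_iff_lt_mul hD).2 hz'
  refine Runs.mono (b := 4 + (4 + (4 + (46 + 1))))
    (Runs.cons <| Runs.assign_eq z (by simp [Expr.eval, Op.eval, h12, h1]) <|
    Runs.cons <| Runs.assign_eq (z / D) (by simp [Expr.eval, Op.eval, h11]) <|
    Runs.cons <| Runs.assign_eq (z % D) (by simp [Expr.eval, Op.eval, h11]) <|
    Runs.cons <| Runs.branch (b := 42) ?_ ?_) le_rfl (fun _ h => h)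
  · intro hne
    have hlt : z / D < M := by simpa [Expr.eval, Op.eval, h9] using hne
    refine (runs_nameNode (leaf := fun d y => shiftSym E.strA s d (P (y - M))) (M := M) (D := D)
      (X := X) (z := z) (by simp [h10]) (by simp [h11]) (by simp)
      (by simp) (by simp) hlt hD hz hX hXw hkeys (by simpa using hN)).mono le_rfl ?_
    rintro st' ⟨hr, hm, hN'⟩
    refine Runs.nil ⟨fun r hr' => ?_, ?_, by simpa using hm, hN'⟩
    · rw [hr r (by omega)]
      simp [show r ≠ 12 by omega, show r ≠ 13 by omega, show r ≠ 14 by omega]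
    · rw [hr 12 le_rfl]; simp
  · intro heq
    have hle : M ≤ z / D := by simpa [Expr.eval, Op.eval, h9] using heq
    refine (runs_nameLeaf (P := P) (M := M) (D := D) (X := X) (z := z) (s := s)
      (by simp [h6]) (by simp [h9]) (by simp) (by simp) (by simp) hle hdiv hD hz hXw hP hA hσ
      (by simpa using h0) (by simpa using hN)).mono (by omega) ?_
    rintro st' ⟨hr, hm, hN'⟩
    refine Runs.nil ⟨fun r hr' => ?_, ?_, by simpa using hm, hN'⟩
    · rw [hr r (by omega)]
      simp [show r ≠ 12 by omega, show r ≠ 13 by omega, show r ≠ 14 by omega]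
    · rw [hr 12 le_rfl]; simp

theorem runs_nameCmd {P : ℕ → ℕ} {s σ : ℕ} (h6 : st.reg 6 = s) (h9 : st.reg 9 = M)
    (h10 : st.reg 10 = X) (h11 : st.reg 11 = D) (hD : 0 < D) (hM : 0 < M) (hX : 2 * M * D < X)
    (hXw : X < 2 ^ E.w) (hkeys : M * X * X ≤ 2 ^ E.w)
    (hP : ∀ j < M, P j + D < X) (hA : ∀ i, E.strA i ≤ σ) (hσ : σ + 1 < X)
    (h0 : ∀ j < M, st.mem 0 j = P j) (h1 : st.mem 1 = fun _ => 0) :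
    Runs E nameCmd st (63 * (2 * M * D) + 20) fun st' =>
      (∀ j < M, st'.mem 0 j = P j) ∧ ∃ cnt,
      Naming (fun d y => shiftSym E.strA s d (P (y - M))) M D X (st'.mem 1) (st'.mem 2) cnt D := by
  have hDD : D ≤ 2 * M * D := Nat.le_mul_of_pos_left _ (by omega)
  have hMM : 2 * M ≤ 2 * M * D := Nat.le_mul_of_pos_right _ hD
  have hc : ∀ x ≤ X, x % 2 ^ E.w = x := fun x hx => Nat.mod_eq_of_lt (by omega)
  -- The loop stops at `D`, because the root has index `1` and the numbers below `D` belong to no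
  -- node.
  let I : ℕ → State → Prop := fun m st' => D + m ≤ 2 * M * D ∧ (∀ r ≤ 11, st'.reg r = st.reg r) ∧
    st'.reg 12 = D + m ∧ st'.mem 0 = st.mem 0 ∧
    Naming (fun d y => shiftSym E.strA s d (P (y - M))) M D X (st'.mem 1) (st'.mem 2)
        (st'.reg 15) (D + m)
  refine Runs.mono (b := 6 + (2 + (((2 * M * D - D) * (3 + 1 + 59) + (3 + 1)) + 1)))
    (Runs.cons <| Runs.assign_eq (2 * M * D) ?_ <|
    Runs.cons <| Runs.assign_eq 0 (by simp [Expr.eval]) <| Runs.cons <|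
    (Runs.loop (e := .bin .lt (.reg 11) (.reg 12)) I ?_ ?_ (2 * M * D - D) _ ?_).mono le_rfl ?_)
    (by omega) (fun _ h => h)
  · simp only [Expr.eval, Op.eval, h9, h11, hc 2 (by omega), hc (2 * M) (by omega)]
    exact hc _ hX.le
  · rintro m s' ⟨hm, hr, h12, hm0, hN⟩
    constructor
    · simp [Expr.eval, Op.eval, hr 11, h11, h12]
    refine (runs_nameStep (z := D + m) (P := P) (s := s) (σ := σ)
      (by rw [hr 6 (by norm_num), h6]) (by rw [hr 9 (by norm_num), h9])
      (by rw [hr 10 (by norm_num), h10]) (by rw [hr 11 (by norm_num), h11]) (by rw [h12]; ring) hD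
      (by omega) (by omega) hX hXw hkeys hP hA hσ (by rwa [hm0]) hN).mono le_rfl ?_
    rintro st' ⟨hr', h12', hm0', hN'⟩
    exact ⟨by omega, fun r h => (hr' r h).trans (hr r h), h12', hm0'.trans hm0, hN'⟩
  · rintro s' ⟨-, hr, h12, -⟩
    simp [Expr.eval, Op.eval, hr 11, h11, h12]
  · refine ⟨by omega, fun r hr => ?_, ?_, by simp, ?_⟩
    · simp [show r ≠ 12 by omega, show r ≠ 15 by omega]
    · simp; omega
    · rw [show D + (2 * M * D - D) = 2 * M * D by omega]
      simpa [h1] using naming_start hD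
  · rintro s' ⟨-, -, -, hm0, hN⟩
    exact Runs.nil ⟨by rwa [hm0], _, hN⟩

end

/-! ### The query -/

/-- The product of the two tests adds a failure only for nodes below `2 * 2 ^ h`, that is, for
unions of whole blocks; failures inside a block are not counted. -/
def lookupStep : Cmd := block [
  .assign 12 (.bin .sub (.reg 12) (.const 1)),
  .branch (.bin .lt (.reg 12) (.reg 9))
    (.store 3 (.reg 12) (.load 1 (.bin .add (.bin .mul (.bin .add (.bin .mul (.reg 12) (.reg 10))
      (.load 3 (.bin .mul (.const 2) (.reg 12)))) (.reg 10))
      (.load 3 (.bin .add (.bin .mul (.const 2) (.reg 12)) (.const 1))))))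
    (.store 3 (.reg 12) (.bin .add (.inB (.load 0 (.bin .sub (.reg 12) (.reg 9)))) (.const 1))),
  .assign 15 (.bin .add (.reg 15) (.bin .mul (.bin .lt (.reg 12) (.bin .mul (.const 2) (.reg 7)))
    (.bin .eq (.load 3 (.reg 12)) (.const 0))))]

/-- Looks up the names of the nodes of the tree of the second string and counts the failures. -/
def lookupCmd : Cmd := block [
  .assign 12 (.bin .mul (.const 2) (.reg 9)),
  .assign 15 (.const 0),
  .loop (.bin .lt (.const 1) (.reg 12)) lookupStep,
  -- The strict comparison with `s * (l + 2) + 1` tests for at most `s * (l + 2)` failures.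
  .assign 0 (.bin .lt (.reg 15)
    (.bin .add (.bin .mul (.reg 6) (.bin .add (.reg 4) (.const 2))) (.const 1)))]

/-! ### Correctness and cost of the lookup program. -/

section

variable {E : Env} {M N X z : ℕ} {st : State} {bl tab : ℕ → ℕ}

theorem Lookup.step {c : ℕ → ℕ} {v : ℕ} (hL : Lookup bl M X tab c (z + 1)) (hz : 1 ≤ z)
    (hv1 : M ≤ z → v = bl z)
    (hv2 : z < M → v = tab (pairKey X z (c (2 * z)) (c (2 * z + 1)))) :
    Lookup bl M X tab (Function.update c z v) z := by
  constructor
  · intro i hi h1 h2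
    by_cases h : i = z
    · subst h; simp [hv1 h1]
    · rw [Function.update_of_ne h]; exact hL.leaf i (by omega) h1 h2
  · intro i hi h1
    rw [Function.update_of_ne (show 2 * i ≠ z by omega),
      Function.update_of_ne (show 2 * i + 1 ≠ z by omega)]
    by_cases h : i = z
    · subst h; simp [hv2 h1]
    · rw [Function.update_of_ne h]; exact hL.node i (by omega) h1

theorem card_zeros_update (c : ℕ → ℕ) (v : ℕ) :
    ((Finset.Ico z N).filter (Function.update c z v · = 0)).card =
      ((Finset.Ico (z + 1) N).filter (c · = 0)).card +
        (if z < N then 1 else 0) * if v = 0 then 1 else 0 := by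
  by_cases hz : z < N
  · rw [card_filter_Ico_add _ (Nat.le_succ z) hz, Nat.Ico_succ_singleton, Finset.filter_singleton,
      if_pos hz, one_mul, add_comm]
    congr 1
    · congr 1
      refine Finset.filter_congr fun i hi => ?_
      rw [Finset.mem_Ico] at hi
      rw [Function.update_of_ne (by omega)]
    · simp only [Function.update_self]
      split_ifs <;> rfl
  · rw [Finset.Ico_eq_empty (by omega), Finset.Ico_eq_empty (by omega)]
    simp [hz]

/-- What holds when the nodes from `z` on have been looked up. -/
structure LookupInv (E : Env) (P : ℕ → ℕ) (M N X : ℕ) (st₀ : State) (z : ℕ) (st : State) :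
    Prop where
  reg : ∀ r ≤ 11, st.reg r = st₀.reg r
  mem : ∀ a ≠ 3, st.mem a = st₀.mem a
  r12 : st.reg 12 = z
  r15 : st.reg 15 = ((Finset.Ico z (2 * N)).filter (st.mem 3 · = 0)).card
  lt : ∀ i, z ≤ i → i < 2 * M → st.mem 3 i < X
  lookup : Lookup (fun y => E.strB (P (y - M)) + 1) M X (st₀.mem 1) (st.mem 3) z

theorem runs_lookupStep {P : ℕ → ℕ} {σ : ℕ} {st₀ : State} (h7 : st₀.reg 7 = N) (h9 : st₀.reg 9 = M)
    (h10 : st₀.reg 10 = X) (hz : 1 ≤ z) (hz' : z < 2 * M) (hNM : N ≤ M) (hX : 2 * M + 2 < X)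
    (hXw : X < 2 ^ E.w) (hkeys : M * X * X ≤ 2 ^ E.w) (hB : ∀ i, E.strB i ≤ σ) (hσ : σ + 1 < X)
    (h0 : ∀ j < M, st₀.mem 0 j = P j) (htab : ∀ a, st₀.mem 1 a < X)
    (hI : LookupInv E P M N X st₀ (z + 1) st) :
    Runs E lookupStep st 42 (LookupInv E P M N X st₀ z) := by
  have hc : ∀ x ≤ X, x % 2 ^ E.w = x := fun x hx => Nat.mod_eq_of_lt (by omega)
  obtain ⟨hreg, hmem, h12, h15, hlt, hL⟩ := hI
  have fin : ∀ v < X, (M ≤ z → v = E.strB (P (z - M)) + 1) →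
      (z < M → v = st₀.mem 1 (pairKey X z (st.mem 3 (2 * z)) (st.mem 3 (2 * z + 1)))) →
      Runs E (block [.assign 15 (.bin .add (.reg 15) (.bin .mul (.bin .lt (.reg 12)
        (.bin .mul (.const 2) (.reg 7))) (.bin .eq (.load 3 (.reg 12)) (.const 0))))])
        ((st.setReg 12 z).setMem 3 z v) (13 + 1) (LookupInv E P M N X st₀ z) := by
    intro v hvX hv1 hv2
    have hcard := card_zeros_update (N := 2 * N) (z := z) (st.mem 3) v
    refine Runs.cons <| Runs.assign_eq (st.reg 15 + (if z < 2 * N then 1 else 0) *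
      if v = 0 then 1 else 0) ?_ <| Runs.nil ⟨fun r hr => ?_, fun a ha => ?_, ?_, ?_, ?_, ?_⟩
    · have hle : ((Finset.Ico z (2 * N)).filter (Function.update (st.mem 3) z v · = 0)).card ≤
          2 * N := (Finset.card_filter_le _ _).trans (by simp)
      rw [hcard, ← h15] at hle
      have e7 : st.reg 7 = N := by rw [hreg 7 (by norm_num), h7]
      simp [Expr.eval, Op.eval, e7, hc 2 (by omega), hc (2 * N) (by omega)]
      refine hc _ ?_
      split_ifs at hle ⊢ <;> omega
    · simp [show r ≠ 12 by omega, show r ≠ 15 by omega, hreg r hr]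
    · simp [ha, hmem a ha]
    · simp
    · simp [hcard, h15]
    · intro i hi hi'
      simp only [State.setReg_mem, State.setMem_mem, if_true, Function.update_apply]
      split_ifs with h
      · exact hvX
      · exact hlt i (by omega) hi'
    · simpa using hL.step hz hv1 hv2
  refine Runs.mono (b := 4 + (24 + (13 + 1)))
    (Runs.cons <| Runs.assign_eq z (by simp [Expr.eval, Op.eval, h12, hc 1 (by omega)]) <|
    Runs.cons <| Runs.branch (b := 20) ?_ ?_) le_rfl (fun _ h => h)
  · intro hne
    have hzM : z < M := by simpa [Expr.eval, Op.eval, hreg 9, h9] using hne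
    refine Runs.store_eq z (st₀.mem 1 (pairKey X z (st.mem 3 (2 * z)) (st.mem 3 (2 * z + 1))))
      (by simp [Expr.eval]) ?_ (fin _ (htab _) (fun h => by omega) fun _ => rfl)
    have hl := hlt (2 * z) (by omega) (by omega)
    have hr := hlt (2 * z + 1) (by omega) (by omega)
    have hkey := lt_of_lt_of_le (pairKey_lt hzM hl hr) hkeys
    have e10 : st.reg 10 = X := by rw [hreg 10 (by norm_num), h10]
    have e2 := hc (2 * z) (by omega)
    have e3 := hc (2 * z + 1) (by omega)
    simp [Expr.eval, Op.eval, e10, hmem 1, hc 2 (by omega), hc 1 (by omega), e2, e3]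
    unfold pairKey at hkey ⊢
    rw [Nat.mod_eq_of_lt hkey]
  · intro heq
    have hzM : M ≤ z := by simpa [Expr.eval, Op.eval, hreg 9, h9] using heq
    have e9 : st.reg 9 = M := by rw [hreg 9 (by norm_num), h9]
    have hb := hB (P (z - M))
    refine (Runs.store_eq z (E.strB (P (z - M)) + 1) (by simp [Expr.eval]) ?_
      (fin _ (by omega) (fun _ => rfl) fun h => by omega)).mono (by simp [Expr.cost])
      (fun _ h => h)
    simp [Expr.eval, Op.eval, e9, hmem 0, h0 (z - M) (by omega), hc 1 (by omega)]
    exact hc _ (by omega)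

theorem runs_lookupCmd {P : ℕ → ℕ} {σ s l : ℕ} (h4 : st.reg 4 = l) (h6 : st.reg 6 = s)
    (h7 : st.reg 7 = N) (h9 : st.reg 9 = M)
    (h10 : st.reg 10 = X) (hM : 0 < M) (hNM : N ≤ M) (hX : 2 * M + 2 < X)
    (hXw : X < 2 ^ E.w) (hkeys : M * X * X ≤ 2 ^ E.w) (hB : ∀ i, E.strB i ≤ σ) (hσ : σ + 1 < X)
    (hsl : s * (l + 2) + l + 2 < X)
    (h0 : ∀ j < M, st.mem 0 j = P j) (htab : ∀ a, st.mem 1 a < X) :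
    Runs E lookupCmd st (46 * (2 * M) + 30) fun st' => ∃ c : ℕ → ℕ,
      Lookup (fun y => E.strB (P (y - M)) + 1) M X (st.mem 1) c 1 ∧
      st'.reg 0 = if ((Finset.Ico 1 (2 * N)).filter (c · = 0)).card ≤ s * (l + 2)
        then 1 else 0 := by
  have hc : ∀ x ≤ X, x % 2 ^ E.w = x := fun x hx => Nat.mod_eq_of_lt (by omega)
  refine Runs.mono (b := 4 + (2 + (((2 * M - 1) * (3 + 1 + 42) + (3 + 1)) + (10 + 1))))
    (Runs.cons <| Runs.assign_eq (2 * M) ?_ <|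
    Runs.cons <| Runs.assign_eq 0 (by simp [Expr.eval]) <| Runs.cons <|
    (Runs.loop (e := .bin .lt (.const 1) (.reg 12))
      (fun m st' => m + 1 ≤ 2 * M ∧ LookupInv E P M N X st (m + 1) st') ?_ ?_ (2 * M - 1) _
      ?_).mono le_rfl ?_)
    (by omega) (fun _ h => h)
  · simp only [Expr.eval, Op.eval, h9, hc 2 (by omega)]
    exact hc _ (by omega)
  · rintro m s' ⟨hm, hI⟩
    constructor
    · simp [Expr.eval, Op.eval, hI.r12, hc 1 (by omega)]
    exact (runs_lookupStep h7 h9 h10 (by omega) (by omega) hNM hX hXw hkeys hB hσ h0 htab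
      hI).mono le_rfl fun _ h => ⟨by omega, h⟩
  · rintro s' ⟨-, hI⟩
    simp [Expr.eval, Op.eval, hI.r12, hc 1 (by omega)]
  -- At `2 * M` the conditions on nodes are vacuous, so the initial contents of array `3` are
  -- irrelevant.
  · refine ⟨by omega, fun r hr => ?_, by simp, ?_, ?_, fun i h1 h2 => ?_,
      ⟨fun i h1 _ h2 => ?_, fun i h1 h2 => ?_⟩⟩
    · simp [show r ≠ 12 by omega, show r ≠ 15 by omega]
    · simp; omega
    · rw [Finset.Ico_eq_empty (by omega)]; rfl
    · omega
    · omega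
    · omega
  · rintro s' ⟨-, hI⟩
    refine Runs.cons <| Runs.assign <| Runs.nil ⟨s'.mem 3, hI.lookup, ?_⟩
    have e4 : s'.reg 4 = l := by rw [hI.reg 4 (by norm_num), h4]
    have e6 : s'.reg 6 = s := by rw [hI.reg 6 (by norm_num), h6]
    have e15 := hI.r15
    simp only [zero_add] at e15
    simp [Expr.eval, Op.eval, e4, e6, e15, hc 2 (by omega), hc 1 (by omega), hc (l + 2) (by omega),
      hc (s * (l + 2)) (by omega), hc (s * (l + 2) + 1) (by omega)]

end


/-! ### Correctness of the answer -/

variable {w : ℕ}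

theorem encode_eq_elim (A : Fin n → Fin σ) (i : ℕ) :
    encode A i = (List.ofFn A)[i]?.elim 0 fun x => (x : ℕ) + 1 := by
  unfold encode
  split_ifs with hi
  · simp [hi]
  · simp [hi]

theorem encode_le (A : Fin n → Fin σ) (i : ℕ) : encode A i ≤ σ := by
  unfold encode
  split_ifs
  · exact (A _).2
  · exact Nat.zero_le _

/-- A sample below a node lies in the interval of positions of that node. -/
theorem samplePos_mem {tape : ℕ → ℕ} {i R y : ℕ} (hk : 1 ≤ k)
    (h1 : i * 2 ^ (R + t) ≤ y) (h2 : y < (i + 1) * 2 ^ (R + t))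
    (hi : 2 ^ h ≤ i * 2 ^ R) :
    (i * 2 ^ R - 2 ^ h) * k ≤ samplePos k t tape (y - 2 ^ h * 2 ^ t) ∧
      samplePos k t tape (y - 2 ^ h * 2 ^ t) < ((i + 1) * 2 ^ R - 2 ^ h) * k := by
  have hT : 0 < 2 ^ t := by positivity
  rw [pow_add, ← mul_assoc] at h1 h2
  have h3 : i * 2 ^ R ≤ y / 2 ^ t := (Nat.le_div_iff_mul_le hT).2 h1
  have h4 : y / 2 ^ t < (i + 1) * 2 ^ R := (Nat.div_lt_iff_lt_mul hT).2 h2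
  have h5 : (y - 2 ^ h * 2 ^ t) / 2 ^ t = y / 2 ^ t - 2 ^ h := by
    rw [mul_comm, Nat.sub_mul_div]
  have h6 := Nat.mod_lt (tape (y - 2 ^ h * 2 ^ t)) hk
  unfold samplePos
  rw [h5]
  constructor
  · exact (Nat.mul_le_mul_right k (Nat.sub_le_sub_right h3 _)).trans (Nat.le_add_right _ _)
  · have h7 : (y / 2 ^ t - 2 ^ h + 1) * k ≤ ((i + 1) * 2 ^ R - 2 ^ h) * k :=
      Nat.mul_le_mul_right k (by omega)
    rw [Nat.succ_mul] at h7
    omega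

/-- The positions in `[a, b)` where `B` differs from `A` under the shift `d - s`. -/
def mismatches (A B : Fin n → Fin σ) (s d a b : ℕ) : Finset ℕ :=
  (Finset.Ico a b).filter fun p => shiftSym (encode A) s d p ≠ encode B p + 1

/-- The samples reveal every shift under which a node has more than `k` mismatches. -/
def Reveals (A B : Fin n → Fin σ) (k s h t : ℕ) (tape : ℕ → ℕ) : Prop :=
  ∀ i R d, 2 ^ h ≤ i * 2 ^ R → (i + 1) * 2 ^ R ≤ 2 * 2 ^ h → R ≤ h → d < 2 * s + 1 →
    (∀ y, i * 2 ^ (R + t) ≤ y → y < (i + 1) * 2 ^ (R + t) →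
      shiftSym (encode A) s d (samplePos k t tape (y - 2 ^ h * 2 ^ t)) =
        encode B (samplePos k t tape (y - 2 ^ h * 2 ^ t)) + 1) →
    (mismatches A B s d ((i * 2 ^ R - 2 ^ h) * k) (((i + 1) * 2 ^ R - 2 ^ h) * k)).card ≤ k

theorem Dims.lookup_ne_zero_iff (hd : Dims w n k σ l s h t) {A B : Fin n → Fin σ} {P : ℕ → ℕ}
    {tab cur c : ℕ → ℕ} {cnt : ℕ}
    (hN : Naming (fun d y => shiftSym (encode A) s d (P (y - 2 ^ h * 2 ^ t))) (2 ^ h * 2 ^ t)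
      (2 * s + 1) (nameBound n σ) tab cur cnt (2 * s + 1))
    (hL : Lookup (fun y => encode B (P (y - 2 ^ h * 2 ^ t)) + 1) (2 ^ h * 2 ^ t) (nameBound n σ)
      tab c 1) {i R : ℕ} (h1 : 2 ^ h ≤ i * 2 ^ R) (h2 : (i + 1) * 2 ^ R ≤ 2 * 2 ^ h) :
    c i ≠ 0 ↔ ∃ d < 2 * s + 1, ∀ y, i * 2 ^ (R + t) ≤ y → y < (i + 1) * 2 ^ (R + t) →
      shiftSym (encode A) s d (P (y - 2 ^ h * 2 ^ t)) = encode B (P (y - 2 ^ h * 2 ^ t)) + 1 := by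
  -- A leaf always has the nonzero name read from `B`; only at proper inner nodes does a nonzero
  -- name certify a match. With `t ≠ 0` every node for a union of blocks is inner.
  have ht : t ≠ 0 := by
    rintro rfl
    have := hd.le_samples
    omega
  have hi : 1 ≤ i := by
    rcases Nat.eq_zero_or_pos i with rfl | hi
    · have : 0 < 2 ^ h := by positivity
      omega
    · exact hi
  refine hN.lookup_ne_zero_iff (by omega) hd.nodes_lt (fun i => ?_) hL hi ?_ ?_ (by omega)
  · have := encode_le B (P (i - 2 ^ h * 2 ^ t))
    have := hd.le_nameBound
    omega
  · rw [pow_add, ← mul_assoc]; exact Nat.mul_le_mul_right _ h1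
  · rw [pow_add, ← mul_assoc, ← mul_assoc]; exact Nat.mul_le_mul_right _ h2

/-- A node whose interval avoids the breakpoints matches some copy at every position, hence at its
samples, whatever they are. -/
theorem Dims.zeros_le_of_editDist_le (hd : Dims w n k σ l s h t) {A B : Fin n → Fin σ}
    {tape tab cur c : ℕ → ℕ} {cnt : ℕ}
    (hN : Naming (fun d y => shiftSym (encode A) s d (samplePos k t tape (y - 2 ^ h * 2 ^ t)))
      (2 ^ h * 2 ^ t) (2 * s + 1) (nameBound n σ) tab cur cnt (2 * s + 1))
    (hL : Lookup (fun y => encode B (samplePos k t tape (y - 2 ^ h * 2 ^ t)) + 1) (2 ^ h * 2 ^ t)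
      (nameBound n σ) tab c 1) (hed : editDist A B ≤ s) :
    zeros c 1 h ≤ s * (l + 2) := by
  obtain ⟨S, hS, H⟩ := (edits_editDist A B).exists_breakpoints
  have hz : zeros c 1 h ≤ (h + 1) * S.card := by
    refine zeros_root_le (k := k) S fun i R h1 h2 _ hci => ?_
    by_contra hcon
    push Not at hcon
    obtain ⟨δ, hδ, hp⟩ := H ((i * 2 ^ R - 2 ^ h) * k) (((i + 1) * 2 ^ R - 2 ^ h) * k)
      (fun p hp1 hp2 hpS => absurd (hcon p hpS hp1) (by omega))
    rw [abs_le] at hδ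
    -- As `|δ| ≤ s`, the shift `δ` belongs to the copy `s + δ` with `0 ≤ s + δ ≤ 2 * s`.
    refine (hd.lookup_ne_zero_iff hN hL h1 h2).2 ⟨((s : ℤ) + δ).toNat, by omega, fun y hy1 hy2 => ?_⟩
      hci
    obtain ⟨hy3, hy4⟩ := samplePos_mem (tape := tape) hd.k_pos hy1 hy2 h1
    generalize samplePos k t tape (y - 2 ^ h * 2 ^ t) = p at *
    obtain ⟨h5, h6⟩ := hp p hy3 hy4
    unfold shiftSym
    rw [if_neg (by omega), encode_eq_elim, encode_eq_elim, ← h6,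
      show p + ((s : ℤ) + δ).toNat - s = ((p : ℤ) + δ).toNat by omega, add_comm]
  have h1 := hd.h_le
  calc zeros c 1 h ≤ (h + 1) * S.card := hz
    _ ≤ (l + 2) * s := Nat.mul_le_mul (by omega) (hS.trans hed)
    _ = _ := mul_comm _ _

theorem Dims.editDist_le_of_zeros_le (hd : Dims w n k σ l s h t) {A B : Fin n → Fin σ}
    {tape tab cur c : ℕ → ℕ} {cnt : ℕ}
    (hN : Naming (fun d y => shiftSym (encode A) s d (samplePos k t tape (y - 2 ^ h * 2 ^ t)))
      (2 ^ h * 2 ^ t) (2 * s + 1) (nameBound n σ) tab cur cnt (2 * s + 1))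
    (hL : Lookup (fun y => encode B (samplePos k t tape (y - 2 ^ h * 2 ^ t)) + 1) (2 ^ h * 2 ^ t)
      (nameBound n σ) tab c 1) (hrev : Reveals A B k s h t tape)
    (hz : zeros c 1 h ≤ s * (l + 2)) : editDist A B ≤ 40 * k ^ 2 := by
  have hn : 0 < n := by have := hd.two_le; omega
  -- The edits are built from functions on `ℕ`; the values of the extension beyond `n` are never
  -- used.
  obtain ⟨ext, hext⟩ : ∃ ext : (Fin n → Fin σ) → ℕ → Fin σ, ∀ F i (hi : i < n),
      ext F i = F ⟨i, hi⟩ := ⟨fun F i => if hi : i < n then F ⟨i, hi⟩ else F ⟨0, hn⟩,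
        fun F i hi => dif_pos hi⟩
  have hseg : ∀ F, seg (ext F) 0 n = List.ofFn F := by
    intro F
    refine List.ext_getElem (by simp) fun i h1 h2 => ?_
    simp only [List.length_ofFn] at h2
    simp [seg, hext F i h2]
  -- `K = 2 * k + 2 * s` covers both costs: `2 * k` for rewriting a block and `k + 2 * s` for a node
  -- that succeeds.
  have key := exists_edits_of_zeros (ext A) (ext B) (c := c) (n := n) (k := k)
    (K := 2 * k + 2 * s) (h := h) (by omega) ?_ h 1 0 n (by simp) (by norm_num) le_rfl
    (by simp) (by
      rw [show (1 + 1) * 2 ^ h - 2 ^ h = 2 ^ h by omega]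
      have := hd.le_blocks; omega)
  · obtain ⟨r, hr, hE⟩ := key
    rw [Nat.sub_zero, hseg, hseg] at hE
    refine (editDist_le hE).trans (hr.trans ?_)
    have h1 := hd.s_mul_le
    have h2 := hd.two_s_le
    have h3 := hd.l_pos
    have h4 := hd.k_pos
    -- From `2 * s * l ≤ k` and `2 * s ≤ k`. Then `(3k/2 + 1) * 3k ≤ 40 * k ^ 2` leaves ample room.
    have h5 : 2 * (s * (l + 2)) ≤ 3 * k := by nlinarith
    nlinarith
  · intro i R a b h1 h2 h3 hci ha hb
    obtain ⟨d, hdD, hmatch⟩ := (hd.lookup_ne_zero_iff hN hL h1 h2).1 hci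
    have hm := hrev i R d h1 h2 h3 hdD hmatch
    obtain ⟨r, hr, hE⟩ := exists_edits_seg_of_shift (ext A) (ext B) a (b - a) s d k (by omega) _ hm
      (by
        intro p hp1 hp2 hp3 hp4 hpS
        have hpn : p < n := by omega
        have hqn : p + d - s < n := by omega
        have heq : shiftSym (encode A) s d p = encode B p + 1 := by
          by_contra hne
          exact hpS (Finset.mem_filter.2 ⟨Finset.mem_Ico.2 ⟨by omega, by omega⟩, hne⟩)
        unfold shiftSym at heq
        rw [if_neg (by omega)] at heq
        unfold encode at heq
        rw [dif_pos hqn, dif_pos hpn] at heq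
        rw [hext A _ hqn, hext B _ hpn]
        exact Fin.ext (by omega))
    exact ⟨r, by omega, hE⟩


/-! ### The samples reveal the mismatches with high probability -/

instance isProbabilityMeasure_tapeMeasure (w : ℕ) : IsProbabilityMeasure (tapeMeasure w) := by
  unfold tapeMeasure; infer_instance

/-- A random word modulo `k` hits each residue with probability at least `1 / (2 * k)`. -/
theorem uniform_mod_notMem_le (hk : 1 ≤ k) (hkw : k ≤ 2 ^ w) (S : Finset ℕ)
    (hS : ∀ o ∈ S, o < k) :
    (PMF.uniformOfFintype (Fin (2 ^ w))).toMeasure {x | (x : ℕ) % k ∉ S} ≤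
      ENNReal.ofReal (Real.exp (-(S.card / (2 * k)))) := by
  classical
  have hV : (0 : ℝ) < 2 ^ w := by positivity
  have hk0 : (0 : ℝ) < k := by exact_mod_cast hk
  rw [PMF.toMeasure_uniformOfFintype_apply _ (Set.toFinite _).measurableSet]
  -- Each residue below `k` is taken by at least `⌊2 ^ w / k⌋` words, and this is at least `2 ^ w /
  -- (2 * k)` because `k ≤ 2 ^ w`.
  have hbad : 2 ^ w / k * S.card ≤ (Finset.univ.filter fun x : Fin (2 ^ w) => (x : ℕ) % k ∈ S).card := by
    rw [← Finset.card_range (2 ^ w / k), ← Finset.card_product]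
    have hlt : ∀ z ∈ Finset.range (2 ^ w / k) ×ˢ S, k * z.1 + z.2 < 2 ^ w := by
      intro z hz
      rw [Finset.mem_product, Finset.mem_range] at hz
      have h1 := hS _ hz.2
      have h2 : k * (z.1 + 1) ≤ k * (2 ^ w / k) := Nat.mul_le_mul_left _ hz.1
      have h3 := Nat.mul_div_le (2 ^ w) k
      rw [Nat.mul_succ] at h2
      omega
    refine Finset.card_le_card_of_injOn (fun z => Fin.ofNat (2 ^ w) (k * z.1 + z.2)) ?_ ?_
    · intro z hz
      have hz' := Finset.mem_product.1 hz
      simp [Nat.mod_eq_of_lt (hlt z hz), Nat.mod_eq_of_lt (hS _ hz'.2), hz'.2]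
    · intro z hz z' hz' heq
      have h1 := hS _ (Finset.mem_product.1 hz).2
      have h2 := hS _ (Finset.mem_product.1 hz').2
      have h3 := congrArg Fin.val heq
      simp only [Fin.val_ofNat, Nat.mod_eq_of_lt (hlt z hz), Nat.mod_eq_of_lt (hlt z' hz')] at h3
      have h4 := congrArg (· % k) h3
      simp only [Nat.mul_add_mod, Nat.mod_eq_of_lt h1, Nat.mod_eq_of_lt h2] at h4
      rw [h4] at h3
      have h5 := Nat.eq_of_mul_eq_mul_left hk (Nat.add_right_cancel h3)
      exact Prod.ext h5 h4
  have hsum := Finset.card_filter_add_card_filter_not (s := (Finset.univ : Finset (Fin (2 ^ w))))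
    (fun x => (x : ℕ) % k ∈ S)
  rw [Finset.card_univ, Fintype.card_fin] at hsum
  have hcard : Fintype.card {x : Fin (2 ^ w) | (x : ℕ) % k ∉ S} =
      (Finset.univ.filter fun x : Fin (2 ^ w) => ¬ (x : ℕ) % k ∈ S).card := by
    rw [← Set.toFinset_card]; congr 1; ext; simp
  rw [hcard, Fintype.card_fin]
  generalize (Finset.univ.filter fun x : Fin (2 ^ w) => ¬ (x : ℕ) % k ∈ S).card = g at *
  have h2 : 2 ^ w ≤ 2 * k * (2 ^ w / k) := by
    have h3 := Nat.div_add_mod (2 ^ w) k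
    have h4 := Nat.mod_lt (2 ^ w) hk
    have h5 : 1 ≤ 2 ^ w / k := (Nat.one_le_div_iff hk).2 hkw
    nlinarith
  have h3 : 2 * k * g + 2 ^ w * S.card ≤ 2 * k * 2 ^ w := by
    have h4 : 2 ^ w * S.card ≤ 2 * k * (2 ^ w / k * S.card) := by
      rw [← mul_assoc]; exact Nat.mul_le_mul_right _ h2
    nlinarith
  have h4 : (g : ℝ) / 2 ^ w ≤ 1 - S.card / (2 * k) := by
    rw [div_le_iff₀ hV, sub_mul, one_mul, div_mul_eq_mul_div, le_sub_iff_add_le,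
      ← le_sub_iff_add_le', div_le_iff₀ (by positivity)]
    have : (2 * k * g + 2 ^ w * S.card : ℝ) ≤ 2 * k * 2 ^ w := by exact_mod_cast h3
    linarith
  have h5 : ((g : ℕ) : ℝ≥0∞) / ((2 ^ w : ℕ) : ℝ≥0∞) = ENNReal.ofReal ((g : ℝ) / 2 ^ w) := by
    rw [ENNReal.ofReal_div_of_pos hV, ENNReal.ofReal_natCast]
    congr 1
    rw [← ENNReal.ofReal_natCast]; push_cast; rfl
  rw [h5]
  refine ENNReal.ofReal_le_ofReal (h4.trans ?_)
  have := Real.add_one_le_exp (-(S.card / (2 * k) : ℝ))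
  linarith

theorem sum_Ico_div (f : ℕ → ℕ) {T u v : ℕ} (huv : u ≤ v) :
    ∑ j ∈ Finset.Ico (u * T) (v * T), f (j / T) = T * ∑ b ∈ Finset.Ico u v, f b := by
  induction v, huv using Nat.le_induction with
  | base => simp
  | succ v hv ih =>
    rw [← Finset.sum_Ico_consecutive _ (Nat.mul_le_mul_right T hv)
      (Nat.mul_le_mul_right T (Nat.le_succ v)), ih, Finset.sum_Ico_succ_top hv, mul_add]
    congr 1
    rw [Finset.sum_congr rfl (g := fun _ => f v), Finset.sum_const, Nat.card_Ico, smul_eq_mul,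
      Nat.succ_mul, Nat.add_sub_cancel_left]
    intro j hj
    rw [Finset.mem_Ico] at hj
    congr 1
    exact Nat.div_eq_of_lt_le hj.1 hj.2

theorem sum_card_filter_blocks (P : ℕ → Prop) [DecidablePred P] {u v : ℕ} (huv : u ≤ v) :
    ∑ b ∈ Finset.Ico u v, ((Finset.range k).filter fun o => P (b * k + o)).card =
      ((Finset.Ico (u * k) (v * k)).filter P).card := by
  induction v, huv using Nat.le_induction with
  | base => simp
  | succ v hv ih =>
    rw [Finset.sum_Ico_succ_top hv, ih, card_filter_Ico_add P (Nat.mul_le_mul_right k hv)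
      (Nat.mul_le_mul_right k (Nat.le_succ v))]
    congr 1
    refine Finset.card_bij (fun o _ => v * k + o) ?_ (fun _ _ _ _ h => by simpa using h) ?_
    · intro o ho
      simp only [Finset.mem_filter, Finset.mem_range, Finset.mem_Ico, Nat.succ_mul] at ho ⊢
      exact ⟨⟨by omega, by omega⟩, ho.2⟩
    · intro p hp
      simp only [Finset.mem_filter, Finset.mem_Ico, Nat.succ_mul] at hp
      refine ⟨p - v * k, ?_, by omega⟩
      simp only [Finset.mem_filter, Finset.mem_range]
      rw [show v * k + (p - v * k) = p by omega]
      exact ⟨by omega, hp.2⟩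

/-- Few tapes miss all of more than `k` positions in a union of blocks. -/
theorem tapeMeasure_miss_le (hk : 1 ≤ k) (hkw : k ≤ 2 ^ w) (P : ℕ → Prop) [DecidablePred P]
    {u v : ℕ} (huv : u ≤ v) (hP : k < ((Finset.Ico (u * k) (v * k)).filter P).card) :
    tapeMeasure w {ω | ∀ j, u * 2 ^ t ≤ j → j < v * 2 ^ t →
      ¬ P (samplePos k t (fun i => (ω i : ℕ)) j)} ≤ ENNReal.ofReal (Real.exp (-(2 ^ t / 2))) := by
  set m : ℕ → ℕ := fun b => ((Finset.range k).filter fun o => P (b * k + o)).card with hm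
  have hsub : {ω : Tape w | ∀ j, u * 2 ^ t ≤ j → j < v * 2 ^ t →
      ¬ P (samplePos k t (fun i => (ω i : ℕ)) j)} ⊆
      Set.pi (Finset.Ico (u * 2 ^ t) (v * 2 ^ t) : Finset ℕ) fun j => {x : Fin (2 ^ w) |
        (x : ℕ) % k ∉ (Finset.range k).filter fun o => P (j / 2 ^ t * k + o)} := by
    intro ω hω j hj
    rw [Finset.mem_coe, Finset.mem_Ico] at hj
    have := hω j hj.1 hj.2
    simp only [Set.mem_ofPred_eq, Finset.mem_filter, not_and]
    exact fun _ => this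
  refine (measure_mono hsub).trans ?_
  -- Independence turns the probability that all samples miss into a product.
  rw [tapeMeasure, Measure.infinitePi_pi _ (fun j _ => (Set.toFinite _).measurableSet)]
  refine (Finset.prod_le_prod' fun j _ => uniform_mod_notMem_le hk hkw _ fun o ho =>
    Finset.mem_range.1 (Finset.mem_filter.1 ho).1).trans ?_
  rw [← ENNReal.ofReal_prod_of_nonneg (fun _ _ => (Real.exp_pos _).le), ← Real.exp_sum]
  refine ENNReal.ofReal_le_ofReal (Real.exp_le_exp.2 ?_)
  -- Every block occurs in the exponent `2 ^ t` times, so the exponent is `-2 ^ t / (2 * k)` times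
  -- the number of positions to be hit, which exceeds `k`.
  rw [Finset.sum_neg_distrib, neg_le_neg_iff, ← Finset.sum_div, ← Nat.cast_sum,
    sum_Ico_div m huv, hm, sum_card_filter_blocks P huv]
  have hk0 : (0 : ℝ) < k := by exact_mod_cast hk
  have hP' : (k : ℝ) ≤ ((Finset.Ico (u * k) (v * k)).filter P).card := by exact_mod_cast hP.le
  rw [div_le_div_iff₀ (by norm_num) (by positivity)]
  push_cast
  have : (0 : ℝ) < 2 ^ t := by positivity
  nlinarith

theorem Dims.tapeMeasure_reveals (hd : Dims w n k σ l s h t) (A B : Fin n → Fin σ) :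
    ENNReal.ofReal (1 - 1 / n) ≤
      tapeMeasure w {ω | Reveals A B k s h t fun i => (ω i : ℕ)} := by
  classical
  have hn0 : (0 : ℝ) < n := by have := hd.two_le; exact_mod_cast (by omega : 0 < n)
  have hkw : k ≤ 2 ^ w := by
    have h1 := hd.nameBound_lt
    have h2 := hd.le_nameBound
    have h3 := hd.k_le
    have h4 : n ≤ n * n := Nat.le_mul_self n
    omega
  let bad : ℕ × ℕ × ℕ → Set (Tape w) := fun x =>
    {ω | 2 ^ h ≤ x.1 * 2 ^ x.2.1 ∧ k < (mismatches A B s x.2.2 ((x.1 * 2 ^ x.2.1 - 2 ^ h) * k)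
        (((x.1 + 1) * 2 ^ x.2.1 - 2 ^ h) * k)).card ∧
      ∀ j, (x.1 * 2 ^ x.2.1 - 2 ^ h) * 2 ^ t ≤ j → j < ((x.1 + 1) * 2 ^ x.2.1 - 2 ^ h) * 2 ^ t →
        ¬ (shiftSym (encode A) s x.2.2 (samplePos k t (fun i => (ω i : ℕ)) j) ≠
          encode B (samplePos k t (fun i => (ω i : ℕ)) j) + 1)}
  let J := Finset.range (2 * 2 ^ h) ×ˢ (Finset.range (h + 1) ×ˢ Finset.range (2 * s + 1))
  -- A violation of `Reveals` is a bad event for one node, one height and one shift.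
  have hcover : (⋃ x ∈ J, bad x)ᶜ ⊆ {ω | Reveals A B k s h t fun i => (ω i : ℕ)} := by
    intro ω hω i R d h1 h2 h3 h4 hmatch
    by_contra hcon
    refine hω (Set.mem_biUnion (x := (i, R, d)) ?_ ⟨h1, not_le.1 hcon, fun j hj1 hj2 => ?_⟩)
    · have : 1 ≤ 2 ^ R := Nat.one_le_two_pow
      have hi : i < 2 * 2 ^ h := by nlinarith
      simp only [J, Finset.coe_product, Set.mem_prod, Finset.mem_coe, Finset.mem_range]
      exact ⟨hi, by omega, h4⟩
    · have e1 : i * 2 ^ (R + t) = (i * 2 ^ R - 2 ^ h) * 2 ^ t + 2 ^ h * 2 ^ t := by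
        rw [← add_mul, Nat.sub_add_cancel h1, pow_add, mul_assoc]
      have h5 : 2 ^ h ≤ (i + 1) * 2 ^ R := h1.trans (Nat.mul_le_mul_right _ (by omega))
      have e2 : (i + 1) * 2 ^ (R + t) = ((i + 1) * 2 ^ R - 2 ^ h) * 2 ^ t + 2 ^ h * 2 ^ t := by
        rw [← add_mul, Nat.sub_add_cancel h5, pow_add, mul_assoc]
      have := hmatch (j + 2 ^ h * 2 ^ t) (by dsimp only at hj1; omega) (by dsimp only at hj2; omega)
      rw [Nat.add_sub_cancel] at this
      exact not_not_intro this
  have hbad : ∀ x ∈ J, tapeMeasure w (bad x) ≤ ENNReal.ofReal (Real.exp (-(2 ^ t / 2))) := by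
    rintro ⟨i, R, d⟩ -
    by_cases hx : 2 ^ h ≤ i * 2 ^ R ∧ k < (mismatches A B s d ((i * 2 ^ R - 2 ^ h) * k)
        (((i + 1) * 2 ^ R - 2 ^ h) * k)).card
    · refine (measure_mono fun ω hω => hω.2.2).trans (tapeMeasure_miss_le hd.k_pos hkw
        (fun p => shiftSym (encode A) s d p ≠ encode B p + 1)
        (Nat.sub_le_sub_right (Nat.mul_le_mul_right _ (Nat.le_succ i)) _) hx.2)
    -- The first two conditions do not involve the tape; if one fails, the event is empty.
    · have : bad (i, R, d) = ∅ := Set.eq_empty_of_forall_notMem fun ω hω => hx ⟨hω.1, hω.2.1⟩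
      simp [this]
  have hunion : tapeMeasure w (⋃ x ∈ J, bad x) ≤ ENNReal.ofReal (1 / n) := by
    refine (measure_biUnion_finset_le J bad).trans ((Finset.sum_le_sum hbad).trans ?_)
    rw [Finset.sum_const, nsmul_eq_mul, ← ENNReal.ofReal_natCast,
      ← ENNReal.ofReal_mul (by positivity)]
    refine ENNReal.ofReal_le_ofReal ?_
    have hJ : J.card ≤ 8 * n * (l + 2) := by
      simp only [J, Finset.card_product, Finset.card_range]
      have h1 := hd.shifts_le
      have h2 : h + 1 ≤ l + 2 := by have := hd.h_le; omega
      calc 2 * 2 ^ h * ((h + 1) * (2 * s + 1)) = 2 * (2 ^ h * (2 * s + 1)) * (h + 1) := by ring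
        _ ≤ 2 * (4 * n) * (l + 2) := Nat.mul_le_mul (Nat.mul_le_mul_left _ h1) h2
        _ = _ := by ring
    have hpow : 8 * n * (l + 2) * n ≤ 2 ^ (8 * (l + 2)) := by
      have h1 := hd.lt_pow_l.le
      have h2 : l + 2 ≤ 2 ^ (l + 2) := Nat.lt_two_pow_self.le
      calc 8 * n * (l + 2) * n ≤ 2 ^ 3 * 2 ^ (l + 1) * 2 ^ (l + 2) * 2 ^ (l + 1) := by gcongr; norm_num
        _ = 2 ^ (3 * l + 7) := by ring
        _ ≤ _ := Nat.pow_le_pow_right (by norm_num) (by omega)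
    -- Here `2 ^ t ≥ 16 * (l + 2)` is used: it makes the exponential beat `n` times the number of
    -- events.
    have hexp : (2 : ℝ) ^ (8 * (l + 2)) ≤ Real.exp (2 ^ t / 2) := by
      have h1 : (2 : ℝ) ≤ Real.exp 1 := by have := Real.add_one_le_exp (1 : ℝ); linarith
      have h2 : ((8 * (l + 2) : ℕ) : ℝ) ≤ 2 ^ t / 2 := by
        have := hd.le_samples
        have h3 : ((16 * (l + 2) : ℕ) : ℝ) ≤ ((2 ^ t : ℕ) : ℝ) := by exact_mod_cast this
        push_cast at h3 ⊢
        linarith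
      calc (2 : ℝ) ^ (8 * (l + 2)) ≤ Real.exp 1 ^ (8 * (l + 2)) := by gcongr
        _ = Real.exp ((8 * (l + 2) : ℕ) : ℝ) := by rw [← Real.exp_nat_mul, mul_one]
        _ ≤ _ := Real.exp_le_exp.2 h2
    rw [Real.exp_neg, ← div_eq_mul_inv, div_le_div_iff₀ (Real.exp_pos _) hn0, one_mul]
    refine le_trans ?_ hexp
    have : J.card * n ≤ 2 ^ (8 * (l + 2)) := (Nat.mul_le_mul_right n hJ).trans hpow
    exact_mod_cast this
  have hone : 1 ≤ tapeMeasure w (⋃ x ∈ J, bad x) + tapeMeasure w (⋃ x ∈ J, bad x)ᶜ := by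
    rw [← measure_univ (μ := tapeMeasure w), ← Set.union_compl_self (⋃ x ∈ J, bad x)]
    exact measure_union_le _ _
  rw [ENNReal.ofReal_sub _ (by positivity), ENNReal.ofReal_one, tsub_le_iff_left]
  exact hone.trans (add_le_add hunion (measure_mono hcover))


/-! ### Preprocessing and query -/

def preCmd : Cmd := block [setupCmd, sampleCmd, nameCmd]

def queryCmd : Cmd := block [setupCmd, lookupCmd]

theorem randFree_queryCmd : queryCmd.RandFree := by
  simp [queryCmd, setupCmd, lookupCmd, lookupStep, doubleCmd, block, Cmd.RandFree]

/-- What the preprocessing leaves in the memory. -/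
def Prepared (n k : ℕ) (A : Fin n → Fin σ) (s h t : ℕ) (tape : ℕ → ℕ) (st : State) : Prop :=
  (∀ j < 2 ^ h * 2 ^ t, st.mem 0 j = samplePos k t tape j) ∧ ∃ cnt,
    Naming (fun d y => shiftSym (encode A) s d (samplePos k t tape (y - 2 ^ h * 2 ^ t)))
      (2 ^ h * 2 ^ t) (2 * s + 1) (nameBound n σ) (st.mem 1) (st.mem 2) cnt (2 * s + 1)

/-- The bound and the invariant hold for every tape. Hence the expected time is bounded trivially,
and every outcome leaves a memory on which queries are fast. -/
theorem runs_preCmd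
    (hd : Dims w n k σ (logParam n) (shiftParam n k) (blockParam n k) (sampleParam n))
    (A : Fin n → Fin σ) (ω : Tape w) :
    Runs (preEnv w A ω) preCmd (preInit w n k σ) (100000 * (n * logParam n))
      (Prepared n k A (shiftParam n k) (blockParam n k) (sampleParam n)
        fun i => (ω i : ℕ)) := by
  have hset := runs_setupCmd (E := preEnv w A ω) (st := preInit w n k σ) hd rfl rfl rfl
  generalize logParam n = l, shiftParam n k = s, blockParam n k = h, sampleParam n = t at hd hset ⊢
  have hX := hd.le_nameBound
  have hn := hd.two_le
  have hnn : n ≤ n * n := Nat.le_mul_self n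
  have hs := hd.two_s_le
  have hk := hd.k_le
  have hM0 : 0 < 2 ^ h * 2 ^ t := by positivity
  have hnodes : 2 * (2 ^ h * 2 ^ t) * (2 * s + 1) ≤ 768 * (n * l) := by
    calc 2 * (2 ^ h * 2 ^ t) * (2 * s + 1) = 2 * (2 ^ h * (2 * s + 1)) * 2 ^ t := by ring
      _ ≤ 2 * (4 * n) * (32 * (3 * l)) := by
        have := hd.l_pos
        exact Nat.mul_le_mul (Nat.mul_le_mul_left _ hd.shifts_le)
          (hd.samples_le.trans (Nat.mul_le_mul_left _ (by omega)))
      _ = _ := by ring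
  have hM : 2 * (2 ^ h * 2 ^ t) ≤ 2 * (2 ^ h * 2 ^ t) * (2 * s + 1) :=
    Nat.le_mul_of_pos_right _ (by omega)
  have hnl : l ≤ n * l := Nat.le_mul_of_pos_left _ (by omega)
  have hl := hd.l_pos
  refine Runs.mono (b := 1500 * l + ((30 * (2 ^ h * 2 ^ t) + 10) +
      ((63 * (2 * (2 ^ h * 2 ^ t) * (2 * s + 1)) + 20) + 1)))
    (Runs.cons <| hset.mono le_rfl ?_) (by omega) (fun _ h => h)
  rintro st₁ ⟨hR₁, hm₁, hp₁⟩
  refine Runs.cons <| (runs_sampleCmd hd hR₁ (by rw [hp₁]; rfl)).mono le_rfl ?_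
  rintro st₂ ⟨hR₂, h0, hm₂⟩
  refine Runs.cons <| (runs_nameCmd (P := samplePos k t fun i => (ω i : ℕ)) (σ := σ) hR₂.r6 hR₂.r9
    hR₂.r10 hR₂.r11 (by omega) hM0 hd.nodes_lt hd.nameBound_lt hd.keys_le (fun j hj => ?_)
    (fun i => encode_le A i) (by omega) h0 ?_).mono le_rfl fun st₃ h₃ => Runs.nil h₃
  · have := hd.samplePos_lt (fun i => (ω i : ℕ)) hj
    omega
  · rw [hm₂ 1 (by norm_num), hm₁]; rfl

/-- Only the LARGE side depends on the samples; the time bound and the SMALL side hold after every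
preprocessing. -/
theorem runs_queryCmd
    (hd : Dims w n k σ (logParam n) (shiftParam n k) (blockParam n k) (sampleParam n))
    (A B : Fin n → Fin σ) {tape : ℕ → ℕ} {st : State}
    (hst : Prepared n k A (shiftParam n k) (blockParam n k) (sampleParam n) tape st) :
    Runs (queryEnv w A B) queryCmd (queryInit w n k σ st)
      (20000 * (2 ^ blockParam n k * logParam n)) fun st' =>
      (editDist A B ≤ shiftParam n k → st'.reg 0 = 1) ∧
      (Reveals A B k (shiftParam n k) (blockParam n k) (sampleParam n) tape →
        40 * k ^ 2 < editDist A B → st'.reg 0 = 0) := by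
  have hset := runs_setupCmd (E := queryEnv w A B) (st := queryInit w n k σ st) hd rfl rfl rfl
  generalize logParam n = l, shiftParam n k = s, blockParam n k = h, sampleParam n = t
    at hd hset hst ⊢
  obtain ⟨h0, cnt, hN⟩ := hst
  have hX := hd.le_nameBound
  have hnodes := hd.nodes_lt
  have hleaves := hd.leaves_le
  have hcnt := hN.cnt_le
  have hnn : 2 * n ≤ n * n := Nat.mul_le_mul_right n hd.two_le
  have hM0 : 0 < 2 ^ h * 2 ^ t := by positivity
  have hl := hd.l_pos
  have hln := hd.l_lt
  have hsl : s * (l + 2) ≤ 2 * k := by have := hd.s_mul_le; nlinarith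
  have hk := hd.k_le
  have hM : 2 ^ h * 2 ^ t ≤ 96 * (2 ^ h * l) := by
    calc 2 ^ h * 2 ^ t ≤ 2 ^ h * (32 * (3 * l)) :=
        Nat.mul_le_mul_left _ (hd.samples_le.trans (Nat.mul_le_mul_left _ (by omega)))
      _ = _ := by ring
  have hhl : l ≤ 2 ^ h * l := Nat.le_mul_of_pos_left _ (by positivity)
  have hNM : 2 ^ h ≤ 2 ^ h * 2 ^ t := Nat.le_mul_of_pos_right _ (by positivity)
  refine Runs.mono (b := 1500 * l + ((46 * (2 * (2 ^ h * 2 ^ t)) + 30) + 1))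
    (Runs.cons <| hset.mono le_rfl ?_) (by omega) (fun _ h => h)
  rintro st₁ ⟨hR, hm, -⟩
  have hm' : st₁.mem = st.mem := hm
  refine Runs.cons <| (runs_lookupCmd (P := samplePos k t tape) (σ := σ) hR.r4 hR.r6 hR.r7 hR.r9
    hR.r10 hM0 hNM (by omega) hd.nameBound_lt hd.keys_le (fun i => encode_le B i) (by omega)
    (by omega) (by rwa [hm']) (fun a => ?_)).mono le_rfl ?_
  · rw [hm']
    have := hN.tab_le a
    omega
  · rintro st₂ ⟨c, hL, hans⟩
    rw [hm'] at hL
    rw [← zeros_root] at hans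
    refine Runs.nil ⟨fun hed => ?_, fun hrev hed => ?_⟩
    · rw [hans, if_pos (hd.zeros_le_of_editDist_le hN hL hed)]
    · rw [hans, if_neg fun hz => ?_]
      have := hd.editDist_le_of_zeros_le hN hL hrev hz
      omega

theorem Dims.l_le_logb {l s h t : ℕ} (hd : Dims w n k σ l s h t) : (l : ℝ) ≤ Real.logb 2 n := by
  have hn : (0 : ℝ) < n := by have := hd.two_le; exact_mod_cast (by omega : 0 < n)
  rw [Real.le_logb_iff_rpow_le (by norm_num) hn, Real.rpow_natCast]
  exact_mod_cast hd.pow_l_le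

/-- Rounding the logarithm down only enlarges `k / (2 * l)`, and an integer below a quotient is
below its integer part. -/
theorem Dims.le_shift {l s h t e : ℕ} (hd : Dims w n k σ l s h t)
    (he : (e : ℝ) ≤ k / (2 * Real.logb 2 n)) : e ≤ s := by
  have hl : (1 : ℝ) ≤ l := by exact_mod_cast hd.l_pos
  have h1 := hd.l_le_logb
  rw [le_div_iff₀ (by linarith)] at he
  have h2 : (e : ℝ) * (2 * l) ≤ k := le_trans (by gcongr) he
  have h3 : e * (2 * l) ≤ k := by exact_mod_cast h2
  rw [hd.s_eq]
  exact (Nat.le_div_iff_mul_le (by have := hd.l_pos; omega)).2 h3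

end GapEdit

end

theorem mainTheorem2 :
    ∃ (pre query : WordRAM.Cmd) (c₀ C c : ℕ), 1 ≤ c₀ ∧ query.RandFree ∧
      ∀ (σ n k : ℕ), 2 ≤ n → 1 ≤ k → k ≤ n →
        -- the preprocessing of `A` takes expected time `Õ(n)`
        (∀ A : Fin n → Fin σ,
          ∫⁻ ω, WordRAM.runtime (GapEdit.preEnv (GapEdit.wordSize c₀ n σ) A ω) pre
              (GapEdit.preInit (GapEdit.wordSize c₀ n σ) n k σ)
              ∂(WordRAM.tapeMeasure (GapEdit.wordSize c₀ n σ))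
            ≤ ENNReal.ofReal (C * n * Real.logb 2 n ^ c)) ∧
        -- whatever the preprocessing has left, every query halts in time `Õ(n / k)`
        (∀ (A B : Fin n → Fin σ) (ω : WordRAM.Tape (GapEdit.wordSize c₀ n σ))
            (s : WordRAM.State) (t : ℕ),
          WordRAM.Exec (GapEdit.preEnv (GapEdit.wordSize c₀ n σ) A ω) pre
              (GapEdit.preInit (GapEdit.wordSize c₀ n σ) n k σ) s t →
          ∃ (s' : WordRAM.State) (t' : ℕ),
            WordRAM.Exec (GapEdit.queryEnv (GapEdit.wordSize c₀ n σ) A B) query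
              (GapEdit.queryInit (GapEdit.wordSize c₀ n σ) n k σ s) s' t' ∧
            (t' : ℝ) ≤ C * ((n : ℝ) / k) * Real.logb 2 n ^ c) ∧
        -- for every `B`, the answer is correct with probability at least `1 - 1 / n` over the
        -- random words that are drawn in the preprocessing
        (∀ A B : Fin n → Fin σ,
          ENNReal.ofReal (1 - 1 / n) ≤
            WordRAM.tapeMeasure (GapEdit.wordSize c₀ n σ)
              {ω | ∃ (s s' : WordRAM.State) (t t' : ℕ),
                WordRAM.Exec (GapEdit.preEnv (GapEdit.wordSize c₀ n σ) A ω) pre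
                  (GapEdit.preInit (GapEdit.wordSize c₀ n σ) n k σ) s t ∧
                WordRAM.Exec (GapEdit.queryEnv (GapEdit.wordSize c₀ n σ) A B) query
                  (GapEdit.queryInit (GapEdit.wordSize c₀ n σ) n k σ s) s' t' ∧
                GapEdit.Correct k A B s'}) := by
  refine ⟨GapEdit.preCmd, GapEdit.queryCmd, 20, 100000, 1, by norm_num,
    GapEdit.randFree_queryCmd, fun σ n k hn hk hkn => ?_⟩
  -- A string is needed here because `σ = 0` is allowed; as `n ≥ 2`, the existence of `A` forces `σ
  -- ≥ 1`.
  have hdims : ∀ _ : Fin n → Fin σ, GapEdit.Dims (GapEdit.wordSize 20 n σ) n k σ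
      (GapEdit.logParam n) (GapEdit.shiftParam n k) (GapEdit.blockParam n k)
      (GapEdit.sampleParam n) := fun A =>
    GapEdit.dims_params hn hk hkn (Nat.lt_of_le_of_lt (Nat.zero_le _) (A ⟨0, by omega⟩).2)
  refine ⟨fun A => ?_, fun A B ω s t hpre => ?_, fun A B => ?_⟩
  · have hd := hdims A
    have hbound : ((100000 * (n * GapEdit.logParam n) : ℕ) : ℝ≥0∞) ≤
        ENNReal.ofReal ((100000 : ℕ) * n * Real.logb 2 n ^ 1) := by
      rw [← ENNReal.ofReal_natCast]
      refine ENNReal.ofReal_le_ofReal ?_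
      push_cast
      rw [pow_one, mul_assoc]
      gcongr
      exact hd.l_le_logb
    calc ∫⁻ ω, WordRAM.runtime (GapEdit.preEnv (GapEdit.wordSize 20 n σ) A ω) GapEdit.preCmd
            (GapEdit.preInit (GapEdit.wordSize 20 n σ) n k σ)
            ∂(WordRAM.tapeMeasure (GapEdit.wordSize 20 n σ))
        ≤ ∫⁻ _, ((100000 * (n * GapEdit.logParam n) : ℕ) : ℝ≥0∞)
            ∂(WordRAM.tapeMeasure (GapEdit.wordSize 20 n σ)) :=
          lintegral_mono fun ω => (GapEdit.runs_preCmd hd A ω).runtime_le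
      _ = ((100000 * (n * GapEdit.logParam n) : ℕ) : ℝ≥0∞) := by simp
      _ ≤ _ := hbound
  · have hd := hdims A
    obtain ⟨s₁, t₁, he, -, hprep⟩ := GapEdit.runs_preCmd hd A ω
    obtain ⟨rfl, -⟩ := he.deterministic hpre
    obtain ⟨s', t', he', ht', -⟩ := GapEdit.runs_queryCmd hd A B hprep
    refine ⟨s', t', he', ?_⟩
    have hk0 : (0 : ℝ) < k := by exact_mod_cast hk
    -- The number of blocks is within a factor `2` of `n / k`, which turns the query constant
    -- `20000` into `40000`.
    have h1 : (2 : ℝ) ^ GapEdit.blockParam n k ≤ 2 * (n / k) := by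
      rw [← mul_div_assoc, le_div_iff₀ hk0]
      exact_mod_cast hd.blocks_le
    have h2 := hd.l_le_logb
    have h3 : (t' : ℝ) ≤ 20000 * (2 ^ GapEdit.blockParam n k * GapEdit.logParam n) := by
      exact_mod_cast ht'
    calc (t' : ℝ) ≤ 20000 * (2 ^ GapEdit.blockParam n k * GapEdit.logParam n) := h3
      _ ≤ 20000 * (2 * (n / k) * Real.logb 2 n) := by gcongr
      _ = 40000 * ((n / k) * Real.logb 2 n) := by ring
      _ ≤ 100000 * ((n / k) * Real.logb 2 n) := by
        have : (0 : ℝ) ≤ Real.logb 2 n := le_trans (by positivity) h2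
        gcongr
        norm_num
      _ = _ := by push_cast; ring
  · have hd := hdims A
    refine (hd.tapeMeasure_reveals A B).trans (measure_mono fun ω hω => ?_)
    obtain ⟨s, t, he, -, hprep⟩ := GapEdit.runs_preCmd hd A ω
    obtain ⟨s', t', he', -, hsmall, hlarge⟩ := GapEdit.runs_queryCmd hd A B hprep
    exact ⟨s, s', t, t', he, he', fun h => hsmall (hd.le_shift h),
      fun h => hlarge hω (by exact_mod_cast h)⟩
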